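/- Let $k$ be a differential field of characteristic $0$ with one derivation $\delta$, and let $R=k\{y_1,\ldots,y_l\}$ be the ring of differential polynomials, that is, the polynomial ring over $k$ in the variables $y_t^{(s)}=\delta^s y_t$ ($1\le t\le l$, $s\ge 0$). Fix a ranking: a total order on these variables such that $\delta^n u\ge u$, and $u\ge v$ implies $\delta^n u\ge\delta^n v$, for all variables $u,v$ and all $n\ge 0$. The leader $u_f$ of $f\in R\setminus k$ is the highest variable appearing in $f$; the initial of $f$ is the leading coefficient of $f$ as a polynomial in $u_f$; the rank of $f$ is the pair $(u_f,\deg_{u_f}f)$, and ranks are compared lexicographically. A polynomial $f$ is reduced with respect to $g\in R\setminus k$ if no proper derivative of $u_g$ appears in $f$ and $\deg_{u_g}f<\deg_{u_g}g$. A set $\mathbb{A}\subset R\setminus k$ is autoreduced if each of its elements is reduced with respect to all the others; such a set is finite, and it is written $A_1,\ldots,A_p$ in order of increasing rank. It has lower rank than an autoreduced set $B_1,\ldots,B_q$ if either there is $n\le p,q$ such that $A_m,B_m$ have the same rank for $m<n$ and $A_n$ has lower rank than $B_n$, or $p>q$ and $A_m,B_m$ have the same rank for all $m\le q$. A characteristic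 set of an ideal is an autoreduced subset of it of lowest rank. Let $P$ be a prime differential ideal of $R$. Then $P$ has a characteristic set $\mathbb{C}=C_1,\ldots,C_p$ ($p\ge0$) with the following properties. (1) $\mathbb{C}$ is irreducible, that is: (a) if $p\ge 1$, then $C_1$ is an irreducible element of $R$; (b) for $1\le i<p$, let $V$ be the set of all variables appearing in $C_1,\ldots,C_i$, let $I_i^\infty$ be the multiplicative set generated by the initials of $C_1,\ldots,C_i$, and let $J=(C_1,\ldots,C_i):I_i^\infty=\{a\in k[V] : sa\in (C_1,\ldots,C_i)\text{ for some }s\in I_i^\infty\}$, where $(C_1,\ldots,C_i)$ is the ideal generated in $k[V]$. Let $U$ be the set of the variables of $C_{i+1}$ that are not in $V$. Then $J$ is prime, and $C_{i+1}$ is irreducible in the ring $\operatorname{Quot}(k[V]/J)[U]$. (2) Let $t$ be such that some derivative of $y_t$ appears in $\mathbb{C}$, let $s$ be the maximal order of a derivative $y_t^{(s)}$ of $y_t$ appearing in $\mathbb{C}$, and suppose that $y_t^{(s)}$ does not appear in $C_1,\ldots,C_{i-1}$ but does appear in $C_i$. Then $\dfrac{\partial C_i}{\partial y_t^{(s)}}\notin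 P$. In particular, this holds whenever $y_t^{(s)}$ is a variable of the maximal order among all variables appearing in $\mathbb{C}$. -/

import Mathlib

namespace DiffAlg

open MvPolynomial

/-- The differential variables of the ordinary ring of differential polynomials in the
indeterminates `y_1, …, y_l`: the pair `(t, s)` stands for `y_t^{(s)}`. -/
abbrev DVar (l : ℕ) : Type := Fin l × ℕ

/-- The ring `k{y_1, …, y_l}`: polynomials over `k` in all the differential variables. -/
abbrev DPoly (l : ℕ) (k : Type*) [CommSemiring k] : Type _ := MvPolynomial (DVar l) k

section Derivation

variable {k : Type*} [CommRing k] [Differential k] {l : ℕ}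

/-- Apply the derivation of `k` to all coefficients of a differential polynomial. -/
noncomputable def coeffDeriv : DPoly l k →+ DPoly l k where
  toFun f := ∑ m ∈ f.support, monomial m (Differential.deriv (coeff m f))
  map_zero' := by simp
  map_add' f g := by
    classical
    have h : ∀ (f : DPoly l k) (n : DVar l →₀ ℕ),
        coeff n (∑ m ∈ f.support, monomial m (Differential.deriv (coeff m f))) =
          Differential.deriv (coeff n f) := by
      intro f n
      rw [coeff_sum]
      simp only [coeff_monomial, Finset.sum_ite_eq']
      split_ifs with hn
      · rfl
      · rw [notMem_support_iff.mp hn, map_zero]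
    ext n
    rw [coeff_add, h, h, h, coeff_add, map_add]

theorem coeff_coeffDeriv (f : DPoly l k) (n : DVar l →₀ ℕ) :
    coeff n (coeffDeriv f) = Differential.deriv (coeff n f) := by
  classical
  change coeff n (∑ m ∈ f.support, monomial m (Differential.deriv (coeff m f))) = _
  rw [coeff_sum]
  simp only [coeff_monomial, Finset.sum_ite_eq']
  split_ifs with hn
  · rfl
  · rw [notMem_support_iff.mp hn, map_zero]

theorem coeffDeriv_monomial (m : DVar l →₀ ℕ) (a : k) :
    coeffDeriv (monomial m a) = (monomial m (Differential.deriv a) : DPoly l k) := by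
  classical
  ext n
  rw [coeff_coeffDeriv, coeff_monomial, coeff_monomial]
  split_ifs <;> simp

theorem coeffDeriv_mul (f g : DPoly l k) :
    coeffDeriv (f * g) = f * coeffDeriv g + g * coeffDeriv f := by
  induction f using MvPolynomial.induction_on' with
  | add p q hp hq => simp only [add_mul, mul_add, map_add, hp, hq]; abel
  | monomial m a =>
    induction g using MvPolynomial.induction_on' with
    | add p q hp hq => simp only [add_mul, mul_add, map_add, hp, hq]; abel
    | monomial n b =>
      simp only [monomial_mul, coeffDeriv_monomial, Derivation.leibniz, smul_eq_mul, map_add]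
      rw [add_comm n m]

/-- The derivation `δ` of `k{y_1, …, y_l}`: it extends the derivation of `k` and sends
`y_t^{(s)}` to `y_t^{(s+1)}`. -/
noncomputable def delta : Derivation ℤ (DPoly l k) (DPoly l k) :=
  Derivation.mk'
    (AddMonoidHom.toIntLinearMap
      (coeffDeriv + (mkDerivation k fun v : DVar l => (X (v.1, v.2 + 1) : DPoly l k)).toLinearMap.toAddMonoidHom))
    (fun f g => by
      have h := (mkDerivation k fun v : DVar l => (X (v.1, v.2 + 1) : DPoly l k)).leibniz f g
      simp only [smul_eq_mul] at h
      change coeffDeriv (f * g) + mkDerivation k _ (f * g) =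
        f • (coeffDeriv g + mkDerivation k _ g) + g • (coeffDeriv f + mkDerivation k _ f)
      rw [h, coeffDeriv_mul]
      simp only [smul_eq_mul]
      ring)

theorem delta_C (a : k) : delta (C a : DPoly l k) = C (Differential.deriv a) := by
  change coeffDeriv (C a) + mkDerivation k _ (C a) = _
  rw [derivation_C, add_zero]
  exact coeffDeriv_monomial 0 a

theorem delta_X (t : Fin l) (s : ℕ) : delta (X (t, s) : DPoly l k) = X (t, s + 1) := by
  change coeffDeriv (X (t, s)) + mkDerivation k _ (X (t, s)) = _
  rw [mkDerivation_X]
  have h : coeffDeriv (X (t, s) : DPoly l k) = 0 := by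
    rw [X, coeffDeriv_monomial, Derivation.map_one_eq_zero, map_zero]
  rw [h, zero_add]

/-- A differential ideal: an ideal closed under the derivation. -/
def IsDifferentialIdeal (P : Ideal (DPoly l k)) : Prop :=
  ∀ f ∈ P, delta f ∈ P

end Derivation

/-- A (differential) ranking on the differential variables: a total order with `θ u ≥ u` and
`u ≥ v → θ u ≥ θ v`, where `θ = δ^n` sends `y_t^{(s)}` to `y_t^{(s+n)}`. -/
structure Ranking (l : ℕ) where
  le : DVar l → DVar l → Prop
  le_refl : ∀ u, le u u
  le_trans : ∀ u v w, le u v → le v w → le u w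
  le_antisymm : ∀ u v, le u v → le v u → u = v
  le_total : ∀ u v, le u v ∨ le v u
  le_derivative : ∀ (u : DVar l) (n : ℕ), le u (u.1, u.2 + n)
  derivative_le_derivative : ∀ (u v : DVar l) (n : ℕ),
    le v u → le (v.1, v.2 + n) (u.1, u.2 + n)

section Rank

variable {k : Type*} [CommRing k] {l : ℕ} (r : Ranking l)

/-- `f ∈ k`. -/
def IsConst (f : DPoly l k) : Prop := ∃ a : k, f = C a

/-- `u` is the leader of `f`: the highest ranked differential variable appearing in `f`
(it exists exactly if `f ∉ k`, and then it is unique). -/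
def IsLeader (f : DPoly l k) (u : DVar l) : Prop :=
  u ∈ f.vars ∧ ∀ v ∈ f.vars, r.le v u

/-- The coefficient of the highest power of the variable `u` in `f`, where `f` is seen as a
univariate polynomial in `u`. -/
noncomputable def leadingCoeffIn (u : DVar l) (f : DPoly l k) : DPoly l k :=
  ∑ m ∈ f.support with m u = f.degreeOf u, monomial (m.erase u) (coeff m f)

/-- `g` is the initial of `f`. -/
def IsInitial (f g : DPoly l k) : Prop :=
  ∃ u, IsLeader r f u ∧ g = leadingCoeffIn u f

/-- For `f, g ∉ k`: the rank of `f` is lower than the rank of `g`. -/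
def RankLT (f g : DPoly l k) : Prop :=
  ∃ u v, IsLeader r f u ∧ IsLeader r g v ∧
    ((r.le u v ∧ u ≠ v) ∨ (u = v ∧ f.degreeOf v < g.degreeOf v))

/-- For `f, g ∉ k`: `f` and `g` have the same rank. -/
def RankEq (f g : DPoly l k) : Prop :=
  ∃ u, IsLeader r f u ∧ IsLeader r g u ∧ f.degreeOf u = g.degreeOf u

/-- For `g ∉ k` with leader `u`: `f` is reduced with respect to `g`, that is, no proper derivative
of `u` appears in `f`, and the degree of `f` in `u` is less than that of `g`. -/
def IsReduced (f g : DPoly l k) : Prop :=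
  ∀ u, IsLeader r g u →
    (∀ n : ℕ, 0 < n → ((u.1, u.2 + n) : DVar l) ∉ f.vars) ∧ f.degreeOf u < g.degreeOf u

/-- An autoreduced set: it contains no element of `k`, and each of its elements is reduced with
respect to all the others. -/
def IsAutoreduced (A : Set (DPoly l k)) : Prop :=
  (∀ f ∈ A, ¬ IsConst f) ∧ ∀ f ∈ A, ∀ g ∈ A, f ≠ g → IsReduced r f g

/-- `A = A_1, …, A_p` is an autoreduced set, enumerated in order of increasing rank. (Autoreduced
sets are finite and their elements have distinct ranks, so that each of them has a unique such
enumeration; the empty set is the case `p = 0`.) -/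
def IsAutoreducedSeq {p : ℕ} (A : Fin p → DPoly l k) : Prop :=
  IsAutoreduced r (Set.range A) ∧ ∀ i j, i < j → RankLT r (A i) (A j)

/-- The autoreduced set `A = A_1, …, A_p` has lower rank than `B = B_1, …, B_q`: they first differ
in rank at some index where `A` has the lower rank, or `p > q` and the ranks agree up to `q`. -/
def SeqRankLT {p q : ℕ} (A : Fin p → DPoly l k) (B : Fin q → DPoly l k) : Prop :=
  (∃ (n : ℕ) (hp : n < p) (hq : n < q),
      (∀ (m : ℕ) (hm : m < n),
        RankEq r (A ⟨m, hm.trans hp⟩) (B ⟨m, hm.trans hq⟩)) ∧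
      RankLT r (A ⟨n, hp⟩) (B ⟨n, hq⟩)) ∨
    ∃ h : q < p, ∀ (m : ℕ) (hm : m < q), RankEq r (A ⟨m, hm.trans h⟩) (B ⟨m, hm⟩)

/-- `A = A_1, …, A_p` is a characteristic set of the ideal `I`: an autoreduced set of lowest rank
among the autoreduced subsets of `I`. -/
def IsCharacteristicSeq (I : Ideal (DPoly l k)) {p : ℕ} (A : Fin p → DPoly l k) : Prop :=
  IsAutoreducedSeq r A ∧ (∀ i, A i ∈ I) ∧
    ∀ (q : ℕ) (B : Fin q → DPoly l k),
      IsAutoreducedSeq r B → (∀ j, B j ∈ I) → ¬ SeqRankLT r B A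

end Rank

/-- The ideal `I : S = {a | ∃ s ∈ S, s a ∈ I}` for a multiplicative set `S`. -/
def colonIdeal {R : Type*} [CommRing R] (I : Ideal R) (S : Submonoid R) : Ideal R where
  carrier := {a | ∃ s ∈ S, s * a ∈ I}
  zero_mem' := ⟨1, S.one_mem, by simp⟩
  add_mem' := by
    rintro a b ⟨s, hs, ha⟩ ⟨t, ht, hb⟩
    refine ⟨s * t, S.mul_mem hs ht, ?_⟩
    have h : s * t * (a + b) = t * (s * a) + s * (t * b) := by ring
    rw [h]
    exact I.add_mem (I.mul_mem_left _ ha) (I.mul_mem_left _ hb)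
  smul_mem' := by
    rintro c a ⟨s, hs, ha⟩
    refine ⟨s, hs, ?_⟩
    have h : s * (c • a) = c * (s * a) := by rw [smul_eq_mul]; ring
    rw [h]
    exact I.mul_mem_left _ ha

section Irreducible

variable {k : Type*} [Field k] {l : ℕ} (r : Ranking l) {p : ℕ} (A : Fin p → DPoly l k)

/-- The set `V` of all variables appearing in the elements preceding `A i`. -/
def prevVars (i : Fin p) : Set (DVar l) := {v | ∃ j < i, v ∈ (A j).vars}

/-- The set `U` of the variables of `A i` that are not in `V`. -/
def newVars (i : Fin p) : Set (DVar l) := {v | v ∈ (A i).vars ∧ v ∉ prevVars A i}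

/-- The ideal of `k[V]` generated by the elements preceding `A i`, saturated by the multiplicative
set generated by their initials. All these polynomials lie in (the image of) `k[V]`. -/
noncomputable def prevIdeal (i : Fin p) : Ideal (MvPolynomial (prevVars A i) k) :=
  colonIdeal
    (Ideal.span {g | ∃ j < i, rename Subtype.val g = A j})
    (Submonoid.closure {g | ∃ j < i, IsInitial r (A j) (rename Subtype.val g)})

/-- `Quot(k[V]/J)`, where `J = prevIdeal r A i`. -/
abbrev PrevFrac (i : Fin p) : Type _ :=
  FractionRing (MvPolynomial (prevVars A i) k ⧸ prevIdeal r A i)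

open Classical in
/-- `A i` as an element of `Quot(k[V]/J)[U]`: the variables in `V` go to their classes, the
variables in `U` to themselves (no other variable appears in `A i`). -/
noncomputable def imageInPrevFrac (i : Fin p) : MvPolynomial (newVars A i) (PrevFrac r A i) :=
  eval₂
    ((C : PrevFrac r A i →+* MvPolynomial (newVars A i) (PrevFrac r A i)).comp
      ((algebraMap (MvPolynomial (prevVars A i) k ⧸ prevIdeal r A i) (PrevFrac r A i)).comp
        ((Ideal.Quotient.mk (prevIdeal r A i)).comp C)))
    (fun v =>
      if hV : v ∈ prevVars A i then
        C (algebraMap (MvPolynomial (prevVars A i) k ⧸ prevIdeal r A i) (PrevFrac r A i)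
          (Ideal.Quotient.mk (prevIdeal r A i) (X ⟨v, hV⟩)))
      else if hU : v ∈ newVars A i then X ⟨v, hU⟩
      else 0)
    (A i)

/-- `A = A_1, …, A_p` is irreducible: `A_1` is irreducible in `k{y_1, …, y_l}`, and each later
element is irreducible in `Quot(k[V]/J)[U]`; the fraction field makes sense, that is, `J` is
prime. -/
def IsIrreducibleSeq : Prop :=
  (∀ i : Fin p, i.val = 0 → Irreducible (A i)) ∧
    ∀ i : Fin p, 0 < i.val →
      (prevIdeal r A i).IsPrime ∧ Irreducible (imageInPrevFrac r A i)

end Irreducible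

end DiffAlg

/-! Among all characteristic sets of `P`, take one that is minimal in a second sense. Give `A i` as
its degree the total degree in its new variables, those that do not occur in earlier members, and
minimize the sequence of these degrees lexicographically. Both claims come from one exchange
principle. A nonzero `f ∈ P` that is reduced with respect to the members before `A i`, has no
variable above the leader `u i`, and has at most the degree of `A i` in `u i` can replace `A i`, and
the result is again a characteristic set. Hence the degree of `f` in the new variables is at least
that of `A i` (`IsMinimalCharacteristicSeq.newDegree_le`).

Derivatives: if `v` is new in `A i`, then `∂A i/∂v` is nonzero in characteristic 0, satisfies the
same reducedness conditions, and has smaller degree in the new variables. So it is not in `P`.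

Primality: `J` is the contraction of `P` to `k[V]`. Initials lie outside `P`, which gives one
inclusion. For the other, pseudo-division of an element of `P ∩ k[V]` by the earlier members leaves
a reduced element of `P` free of `u i`, which must be 0 because the set is characteristic.

Irreducibility: if the image of `A i` over `Quot(k[V]/J)` is `f * g`, clear denominators. The
product of the two lifts lies in `P`, so one lift does, say that of `f`. Pseudo-division by the
earlier members makes it reduced without raising degrees in new variables and without making it 0.
By exchange, `f` has at least the degree of `A i`, so `g` has degree 0 and is a unit.

All degree bounds are stated for arbitrary weights on the variables, so that one estimate covers
degrees in a single variable, degrees in the new variables, and the absence of a variable. -/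

namespace DiffAlg

open MvPolynomial

/-! ### Weighted degrees of polynomials -/

section Weight

variable {σ τ R S : Type*} [CommSemiring R] [CommSemiring S] {w : σ → ℕ}

theorem weightedTotalDegree_le_iff {f : MvPolynomial σ R} {n : ℕ} :
    weightedTotalDegree w f ≤ n ↔ ∀ m ∈ f.support, Finsupp.weight w m ≤ n :=
  Finset.sup_le_iff

theorem weightedTotalDegree_add_le (f g : MvPolynomial σ R) :
    weightedTotalDegree w (f + g) ≤ max (weightedTotalDegree w f) (weightedTotalDegree w g) := by
  classical
  rw [weightedTotalDegree_le_iff]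
  intro m hm
  rcases Finset.mem_union.mp (support_add hm) with h | h
  · exact (le_weightedTotalDegree w h).trans (le_max_left _ _)
  · exact (le_weightedTotalDegree w h).trans (le_max_right _ _)

theorem weightedTotalDegree_mul_le (f g : MvPolynomial σ R) :
    weightedTotalDegree w (f * g) ≤ weightedTotalDegree w f + weightedTotalDegree w g := by
  classical
  rw [weightedTotalDegree_le_iff]
  intro m hm
  obtain ⟨a, ha, b, hb, rfl⟩ := Finset.mem_add.mp (support_mul f g hm)
  rw [map_add]
  exact add_le_add (le_weightedTotalDegree w ha) (le_weightedTotalDegree w hb)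

theorem weightedTotalDegree_C (a : R) : weightedTotalDegree w (C a : MvPolynomial σ R) = 0 := by
  classical
  rw [← Nat.le_zero, weightedTotalDegree_le_iff]
  intro m hm
  rw [mem_support_iff, coeff_C] at hm
  have : m = 0 := by by_contra h; exact hm (if_neg (Ne.symm h))
  simp [this]

theorem weightedTotalDegree_X_le (v : σ) :
    weightedTotalDegree w (X v : MvPolynomial σ R) ≤ w v := by
  classical
  rw [weightedTotalDegree_le_iff]
  intro m hm
  rw [mem_support_iff, coeff_X] at hm
  have : Finsupp.single v 1 = m := by by_contra h; exact hm (if_neg h)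
  simp [← this, Finsupp.weight_single]

theorem weightedTotalDegree_pow_le (f : MvPolynomial σ R) (n : ℕ) :
    weightedTotalDegree w (f ^ n) ≤ n * weightedTotalDegree w f := by
  induction n with
  | zero => rw [pow_zero, ← C_1, weightedTotalDegree_C]; simp
  | succ n ih =>
    rw [pow_succ, add_mul, one_mul]
    exact (weightedTotalDegree_mul_le _ _).trans (by gcongr)

theorem weightedTotalDegree_sum_le {ι : Type*} (s : Finset ι) (f : ι → MvPolynomial σ R) {n : ℕ}
    (h : ∀ i ∈ s, weightedTotalDegree w (f i) ≤ n) :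
    weightedTotalDegree w (∑ i ∈ s, f i) ≤ n := by
  classical
  induction s using Finset.induction_on with
  | empty => rw [Finset.sum_empty, weightedTotalDegree_zero]; exact Nat.zero_le n
  | insert a s ha ih =>
    rw [Finset.sum_insert ha]
    exact (weightedTotalDegree_add_le _ _).trans
      (max_le (h a (s.mem_insert_self a)) (ih fun i hi => h i (Finset.mem_insert_of_mem hi)))

theorem weightedTotalDegree_prod_le {ι : Type*} (s : Finset ι) (f : ι → MvPolynomial σ R) :
    weightedTotalDegree w (∏ i ∈ s, f i) ≤ ∑ i ∈ s, weightedTotalDegree w (f i) := by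
  classical
  induction s using Finset.induction_on with
  | empty => rw [Finset.prod_empty, ← C_1, weightedTotalDegree_C]; simp
  | insert a s ha ih =>
    rw [Finset.prod_insert ha, Finset.sum_insert ha]
    exact (weightedTotalDegree_mul_le _ _).trans (by gcongr)

theorem weightedTotalDegree_eq_zero_of_vars {f : MvPolynomial σ R} (h : ∀ v ∈ f.vars, w v = 0) :
    weightedTotalDegree w f = 0 := by
  rw [← Nat.le_zero, weightedTotalDegree_le_iff]
  intro m hm
  rw [Finsupp.weight_apply, Finsupp.sum]
  refine (Finset.sum_eq_zero fun v hv => ?_).le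
  rw [h v ((mem_vars_iff_mem_support v).mpr ⟨m, hm, hv⟩), smul_zero]

/-- It suffices to look at one monomial, where the bound is subadditivity over products. This
controls the passage between `k[σ]`, `k[V][U]` and `Quot(k[V]/J)[U]`. -/
theorem weightedTotalDegree_map_le {w' : τ → ℕ} (φ : MvPolynomial σ R →+* MvPolynomial τ S)
    (hC : ∀ a, weightedTotalDegree w' (φ (C a)) = 0)
    (hX : ∀ v, weightedTotalDegree w' (φ (X v)) ≤ w v) (f : MvPolynomial σ R) :
    weightedTotalDegree w' (φ f) ≤ weightedTotalDegree w f := by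
  conv_lhs => rw [f.as_sum, map_sum]
  refine weightedTotalDegree_sum_le _ _ fun m hm => ?_
  refine le_trans ?_ (le_weightedTotalDegree w hm)
  rw [monomial_eq, map_mul, Finsupp.prod, map_prod, Finsupp.weight_apply, Finsupp.sum]
  refine (weightedTotalDegree_mul_le _ _).trans ?_
  rw [hC, zero_add]
  refine (weightedTotalDegree_prod_le _ _).trans (Finset.sum_le_sum fun v _ => ?_)
  rw [map_pow, smul_eq_mul]
  exact (weightedTotalDegree_pow_le _ _).trans (Nat.mul_le_mul_left _ (hX v))

theorem degreeOf_pos_iff_mem_vars {f : MvPolynomial σ R} {v : σ} :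
    0 < f.degreeOf v ↔ v ∈ f.vars := by
  classical
  rw [degreeOf_def, Multiset.count_pos, vars_def, Multiset.mem_toFinset]

end Weight

section Sub

variable {σ R : Type*} [CommRing R] {w : σ → ℕ}

theorem weightedTotalDegree_sub_le (f g : MvPolynomial σ R) :
    weightedTotalDegree w (f - g) ≤ max (weightedTotalDegree w f) (weightedTotalDegree w g) := by
  rw [sub_eq_add_neg]
  refine (weightedTotalDegree_add_le _ _).trans_eq ?_
  rw [weightedTotalDegree, weightedTotalDegree, weightedTotalDegree, support_neg]

end Sub

/-! ### Initials and algebraic pseudo-division -/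

section PseudoDivision

variable {k : Type*} [CommRing k] {l : ℕ}

theorem leadingCoeffIn_mul_X_pow_add (u : DVar l) (f : DPoly l k) :
    f = leadingCoeffIn u f * X u ^ f.degreeOf u +
      ∑ m ∈ f.support with ¬ m u = f.degreeOf u, monomial m (coeff m f) := by
  classical
  conv_lhs => rw [f.as_sum, ← Finset.sum_filter_add_sum_filter_not _ (fun m => m u = f.degreeOf u)]
  congr 1
  rw [leadingCoeffIn, Finset.sum_mul]
  refine Finset.sum_congr rfl fun m hm => ?_
  rw [X_pow_eq_monomial, monomial_mul, mul_one, ← (Finset.mem_filter.mp hm).2,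
    Finsupp.erase_add_single]

theorem degreeOf_sum_lower_lt {u : DVar l} {f : DPoly l k} (hf : 0 < f.degreeOf u) :
    degreeOf u (∑ m ∈ f.support with ¬ m u = f.degreeOf u, monomial m (coeff m f)) <
      f.degreeOf u := by
  classical
  refine (degreeOf_sum_le u _ _).trans_lt ((Finset.sup_lt_iff hf).mpr fun m hm => ?_)
  obtain ⟨h1, h2⟩ := Finset.mem_filter.mp hm
  rw [degreeOf_monomial_eq _ _ (mem_support_iff.mp h1)]
  exact lt_of_le_of_ne (le_degreeOf_of_mem_support u h1) h2

/-- Each monomial of the coefficient arises from one of `f` by removing the full power of `u`. The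
`max` on the right is the truncated subtraction of the proof, written additively. -/
theorem weightedTotalDegree_leadingCoeffIn_le (w : DVar l → ℕ) (u : DVar l) (f : DPoly l k) :
    weightedTotalDegree w (leadingCoeffIn u f) + f.degreeOf u * w u ≤
      max (weightedTotalDegree w f) (f.degreeOf u * w u) := by
  classical
  suffices h : weightedTotalDegree w (leadingCoeffIn u f) ≤
      weightedTotalDegree w f - f.degreeOf u * w u by omega
  refine weightedTotalDegree_sum_le _ _ fun m hm => ?_
  obtain ⟨h1, h2⟩ := Finset.mem_filter.mp hm
  rw [weightedTotalDegree_le_iff]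
  intro n hn
  have hn' : n = m.erase u := by simpa using support_monomial_subset hn
  have h3 := le_weightedTotalDegree w h1
  have h4 : Finsupp.weight w m = Finsupp.weight w (m.erase u) + m u * w u := by
    conv_lhs => rw [← Finsupp.erase_add_single u m]
    rw [map_add, Finsupp.weight_single, smul_eq_mul]
  rw [hn', ← h2]
  omega

theorem weightedTotalDegree_leadingCoeffIn_le_self (w : DVar l → ℕ) (u : DVar l) (f : DPoly l k) :
    weightedTotalDegree w (leadingCoeffIn u f) ≤ weightedTotalDegree w f := by
  have := weightedTotalDegree_leadingCoeffIn_le w u f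
  omega

theorem degreeOf_leadingCoeffIn_le (v u : DVar l) (f : DPoly l k) :
    degreeOf v (leadingCoeffIn u f) ≤ degreeOf v f := by
  classical
  rw [← weightedTotalDegree_piSingle, ← weightedTotalDegree_piSingle]
  exact weightedTotalDegree_leadingCoeffIn_le_self _ u f

theorem degreeOf_leadingCoeffIn_self (u : DVar l) (f : DPoly l k) :
    degreeOf u (leadingCoeffIn u f) = 0 := by
  classical
  have h := weightedTotalDegree_leadingCoeffIn_le (Pi.single u 1) u f
  rw [weightedTotalDegree_piSingle, weightedTotalDegree_piSingle, Pi.single_eq_same] at h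
  omega

theorem leadingCoeffIn_ne_zero {u : DVar l} {f : DPoly l k} (hf : 0 < f.degreeOf u) :
    leadingCoeffIn u f ≠ 0 := by
  intro h
  have h1 := degreeOf_sum_lower_lt hf
  have h2 := leadingCoeffIn_mul_X_pow_add u f
  rw [h, zero_mul, zero_add] at h2
  rw [← h2] at h1
  exact lt_irrefl _ h1

/-- Subtracting `leadingCoeffIn u f * u^(e-d) * g` cancels the top power of `u`. If `w` vanishes on
the variables of `g`, then `u`, `g` and its leading coefficient have weight 0, so multiplying by
them costs nothing. -/
theorem exists_pseudoDivision_step (u : DVar l) (f g : DPoly l k) (hg : 0 < g.degreeOf u)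
    (hfg : g.degreeOf u ≤ f.degreeOf u) :
    ∃ q r : DPoly l k, leadingCoeffIn u g * f = q * g + r ∧ r.degreeOf u < f.degreeOf u ∧
      ∀ w : DVar l → ℕ, (∀ v ∈ g.vars, w v = 0) →
        weightedTotalDegree w r ≤ weightedTotalDegree w f := by
  classical
  set a := leadingCoeffIn u g with ha
  set b := leadingCoeffIn u f with hb
  set d := g.degreeOf u with hd
  set e := f.degreeOf u with he
  refine ⟨b * X u ^ (e - d), a * f - b * X u ^ (e - d) * g, by ring, ?_, ?_⟩
  · have hf' := leadingCoeffIn_mul_X_pow_add u f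
    have hg' := leadingCoeffIn_mul_X_pow_add u g
    have hf1 := degreeOf_sum_lower_lt (hg.trans_le hfg)
    have hg1 := degreeOf_sum_lower_lt hg
    set F := ∑ m ∈ f.support with ¬ m u = f.degreeOf u, monomial m (coeff m f)
    set G := ∑ m ∈ g.support with ¬ m u = g.degreeOf u, monomial m (coeff m g)
    rw [← ha, ← hd] at hg'
    rw [← hb, ← he] at hf'
    have key : a * f - b * X u ^ (e - d) * g = a * F - b * X u ^ (e - d) * G := by
      have hX : (X u : DPoly l k) ^ (e - d) * X u ^ d = X u ^ e := by
        rw [← pow_add, Nat.sub_add_cancel hfg]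
      rw [hf', hg']
      linear_combination (-(b * a)) * hX
    have ha0 : degreeOf u a = 0 := degreeOf_leadingCoeffIn_self u g
    have hb0 : degreeOf u b = 0 := degreeOf_leadingCoeffIn_self u f
    have h1 : degreeOf u (a * F) < e := (degreeOf_mul_le u _ _).trans_lt (by omega)
    have hXle : degreeOf u ((X u : DPoly l k) ^ (e - d)) ≤ e - d := by
      refine (degreeOf_pow_le u _ _).trans ?_
      have : degreeOf u (X u : DPoly l k) ≤ 1 := by
        rw [← weightedTotalDegree_piSingle]
        exact (weightedTotalDegree_X_le u).trans_eq (by simp)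
      calc (e - d) * degreeOf u (X u : DPoly l k) ≤ (e - d) * 1 := Nat.mul_le_mul_left _ this
        _ = e - d := mul_one _
    have h2 : degreeOf u (b * X u ^ (e - d) * G) < e := by
      have h3 := degreeOf_mul_le u (b * X u ^ (e - d)) G
      have h4 := degreeOf_mul_le u b (X u ^ (e - d))
      omega
    rw [key]
    rw [← weightedTotalDegree_piSingle] at h1 h2 ⊢
    exact (weightedTotalDegree_sub_le _ _).trans_lt (max_lt h1 h2)
  · intro w hw
    have hg0 := weightedTotalDegree_eq_zero_of_vars hw
    have ha0 : weightedTotalDegree w a = 0 := by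
      have h := weightedTotalDegree_leadingCoeffIn_le_self w u g
      rwa [hg0, Nat.le_zero] at h
    have hu : w u = 0 := hw u (degreeOf_pos_iff_mem_vars.mp hg)
    have hX0 : weightedTotalDegree w ((X u : DPoly l k) ^ (e - d)) = 0 := by
      have h1 := weightedTotalDegree_pow_le (w := w) (X u : DPoly l k) (e - d)
      have h2 : weightedTotalDegree w (X u : DPoly l k) ≤ w u := weightedTotalDegree_X_le u
      rw [hu, Nat.le_zero] at h2
      rw [h2] at h1
      omega
    have hb1 : weightedTotalDegree w b ≤ weightedTotalDegree w f :=
      weightedTotalDegree_leadingCoeffIn_le_self w u f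
    have h1 := weightedTotalDegree_mul_le (w := w) a f
    have h2 := weightedTotalDegree_mul_le (w := w) (b * X u ^ (e - d)) g
    have h3 := weightedTotalDegree_mul_le (w := w) b (X u ^ (e - d))
    refine (weightedTotalDegree_sub_le _ _).trans (max_le ?_ ?_)
    · rw [ha0] at h1; omega
    · rw [hg0] at h2; rw [hX0] at h3; omega

theorem exists_pseudoDivision (u : DVar l) (f g : DPoly l k) (hg : 0 < g.degreeOf u) :
    ∃ (n : ℕ) (q r : DPoly l k), leadingCoeffIn u g ^ n * f = q * g + r ∧
      r.degreeOf u < g.degreeOf u ∧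
      ∀ w : DVar l → ℕ, (∀ v ∈ g.vars, w v = 0) →
        weightedTotalDegree w r ≤ weightedTotalDegree w f := by
  induction h : f.degreeOf u using Nat.strong_induction_on generalizing f with
  | _ e ih =>
    by_cases hfg : g.degreeOf u ≤ f.degreeOf u
    · obtain ⟨q, r, h1, h2, h3⟩ := exists_pseudoDivision_step u f g hg hfg
      obtain ⟨n, q', r', h1', h2', h3'⟩ := ih _ (h ▸ h2) r rfl
      refine ⟨n + 1, leadingCoeffIn u g ^ n * q + q', r', ?_, h2', fun w hw =>
        (h3' w hw).trans (h3 w hw)⟩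
      rw [pow_succ, mul_assoc, h1, mul_add, h1']
      ring
    · exact ⟨0, 0, f, by ring, not_le.mp hfg, fun w _ => le_rfl⟩

/-- Successive pseudo-division by the first `n` members of a triangular family. -/
theorem exists_remainder {p : ℕ} (A : Fin p → DPoly l k) (u : Fin p → DVar l)
    (hu : ∀ i, u i ∈ (A i).vars) (hlt : ∀ i j, i < j → u j ∉ (A i).vars) (n : ℕ) (f : DPoly l k) :
    ∃ s ∈ Submonoid.closure {g | ∃ j : Fin p, j.val < n ∧ g = leadingCoeffIn (u j) (A j)},
      ∃ r : DPoly l k, s * f - r ∈ Ideal.span {g | ∃ j : Fin p, j.val < n ∧ g = A j} ∧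
        (∀ j : Fin p, j.val < n → r.degreeOf (u j) < (A j).degreeOf (u j)) ∧
        ∀ w : DVar l → ℕ, (∀ j : Fin p, j.val < n → ∀ v ∈ (A j).vars, w v = 0) →
          weightedTotalDegree w r ≤ weightedTotalDegree w f := by
  classical
  induction n generalizing f with
  | zero => exact ⟨1, one_mem _, f, by simp, by simp, by simp⟩
  | succ n ih =>
    by_cases hn : n < p
    -- Divide by the last member first. The later divisions, by earlier members, then preserve what
    -- was achieved in its leader.
    · obtain ⟨e, q, r₁, h1, h2, h3⟩ := exists_pseudoDivision (u ⟨n, hn⟩) f (A ⟨n, hn⟩)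
        (degreeOf_pos_iff_mem_vars.mpr (hu _))
      obtain ⟨s, hs, r, h4, h5, h6⟩ := ih r₁
      refine ⟨s * leadingCoeffIn (u ⟨n, hn⟩) (A ⟨n, hn⟩) ^ e, ?_, r, ?_, ?_, ?_⟩
      · refine mul_mem ?_ (pow_mem (Submonoid.subset_closure ?_) e)
        swap
        · exact ⟨⟨n, hn⟩, Nat.lt_succ_self n, rfl⟩
        refine Submonoid.closure_mono ?_ hs
        rintro g ⟨j, hj, hg⟩
        exact ⟨j, hj.trans (Nat.lt_succ_self n), hg⟩
      · have h7 : s * leadingCoeffIn (u ⟨n, hn⟩) (A ⟨n, hn⟩) ^ e * f - r =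
            s * q * A ⟨n, hn⟩ + (s * r₁ - r) := by
          rw [mul_assoc, h1]; ring
        rw [h7]
        refine add_mem (Ideal.mul_mem_left _ _
          (Ideal.subset_span ⟨⟨n, hn⟩, Nat.lt_succ_self n, rfl⟩)) ?_
        refine Ideal.span_mono ?_ h4
        rintro g ⟨j, hj, hg⟩
        exact ⟨j, hj.trans (Nat.lt_succ_self n), hg⟩
      · intro j hj
        rcases Nat.lt_succ_iff_lt_or_eq.mp hj with hj | hj
        · exact h5 j hj
        · obtain rfl : j = ⟨n, hn⟩ := Fin.ext hj
          refine lt_of_le_of_lt ?_ h2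
          -- The weight counting only this leader vanishes on the earlier members, so dividing by
          -- them does not raise the degree in it.
          have := h6 (Pi.single (u ⟨n, hn⟩) 1) fun i hi v hv => by
            refine Pi.single_eq_of_ne ?_ _
            rintro rfl
            exact hlt i ⟨n, hn⟩ hi hv
          rwa [weightedTotalDegree_piSingle, weightedTotalDegree_piSingle] at this
      · intro w hw
        exact (h6 w fun j hj => hw j (hj.trans (Nat.lt_succ_self n))).trans
          (h3 w (hw ⟨n, hn⟩ (Nat.lt_succ_self n)))
    · have h : ∀ j : Fin p, j.val < n + 1 ↔ j.val < n := fun j => by omega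
      simpa only [h] using ih f

end PseudoDivision

/-! ### Rankings are well-orders -/

namespace Ranking

variable {l : ℕ} (r : Ranking l)

/-- The strict order of a ranking. -/
def lt (u v : DVar l) : Prop := r.le u v ∧ u ≠ v

variable {r}

theorem lt_irrefl (u : DVar l) : ¬ r.lt u u := fun h => h.2 rfl

theorem lt_of_le_of_lt {u v w : DVar l} (h : r.le u v) (h' : r.lt v w) : r.lt u w :=
  ⟨r.le_trans _ _ _ h h'.1, fun e => h'.2 (r.le_antisymm _ _ h'.1 (e ▸ h))⟩

theorem lt_trans {u v w : DVar l} (h : r.lt u v) (h' : r.lt v w) : r.lt u w :=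
  lt_of_le_of_lt h.1 h'

theorem not_le_of_lt {u v : DVar l} (h : r.lt u v) : ¬ r.le v u :=
  fun h' => h.2 (r.le_antisymm _ _ h.1 h')

theorem lt_or_eq_of_le {u v : DVar l} (h : r.le u v) : r.lt u v ∨ u = v := by
  by_cases e : u = v
  · exact Or.inr e
  · exact Or.inl ⟨h, e⟩

theorem lt_trichotomy (u v : DVar l) : r.lt u v ∨ u = v ∨ r.lt v u := by
  rcases r.le_total u v with h | h
  · exact (lt_or_eq_of_le h).imp_right Or.inl
  · rcases lt_or_eq_of_le h with h | h
    · exact Or.inr (Or.inr h)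
    · exact Or.inr (Or.inl h.symm)

theorem lt_derivative (u : DVar l) {n : ℕ} (hn : 0 < n) : r.lt u (u.1, u.2 + n) := by
  refine ⟨r.le_derivative u n, fun h => ?_⟩
  have := congrArg Prod.snd h
  simp only at this
  omega

variable (r)

/-- A ranking is a well-order, by Dickson's lemma. -/
theorem lt_wellFounded : WellFounded r.lt := by
  have h1 : WellQuasiOrdered fun a b : DVar l => a.1 = b.1 ∧ a.2 ≤ b.2 :=
    (Finite.wellQuasiOrdered (α := Fin l) (· = ·)).prod (wellQuasiOrdered_le (α := ℕ))
  have h2 : WellQuasiOrdered r.le := fun f => by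
    obtain ⟨m, n, hmn, h, h'⟩ := h1 f
    refine ⟨m, n, hmn, ?_⟩
    -- For a fixed indeterminate, a higher order means a derivative, so the ranking extends the
    -- Dickson order `h1`.
    have h3 := r.le_derivative (f m) ((f n).2 - (f m).2)
    rwa [Nat.add_sub_cancel' h', h] at h3
  have : IsPreorder (DVar l) r.le := { refl := r.le_refl, trans := r.le_trans }
  refine Subrelation.wf (r := fun u v => r.le u v ∧ ¬ r.le v u) ?_ h2.wellFounded
  intro u v h
  exact ⟨h.1, not_le_of_lt h⟩

/-- The position of a differential variable in the well-order of a ranking. -/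
noncomputable def position (u : DVar l) : Ordinal.{0} :=
  @IsWellFounded.rank _ r.lt ⟨r.lt_wellFounded⟩ u

variable {r}

theorem position_lt {u v : DVar l} (h : r.lt u v) : r.position u < r.position v :=
  IsWellFounded.rank_lt_of_rel (hwf := ⟨r.lt_wellFounded⟩) h

end Ranking

/-! ### Leaders and ranks of polynomials -/

section Leader

variable {k : Type*} [CommRing k] {l : ℕ} {r : Ranking l}

theorem IsLeader.unique {f : DPoly l k} {u v : DVar l} (hu : IsLeader r f u)
    (hv : IsLeader r f v) : u = v :=
  r.le_antisymm _ _ (hv.2 _ hu.1) (hu.2 _ hv.1)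

theorem IsLeader.degreeOf_pos {f : DPoly l k} {u : DVar l} (hu : IsLeader r f u) :
    0 < f.degreeOf u :=
  degreeOf_pos_iff_mem_vars.mpr hu.1

theorem IsLeader.notMem_vars_of_lt {f : DPoly l k} {u v : DVar l} (hu : IsLeader r f u)
    (h : r.lt u v) : v ∉ f.vars :=
  fun hv => Ranking.not_le_of_lt h (hu.2 _ hv)

theorem IsLeader.not_isConst {f : DPoly l k} {u : DVar l} (hu : IsLeader r f u) :
    ¬ IsConst f := by
  rintro ⟨a, rfl⟩
  have := hu.1
  simp at this

theorem degreeOf_eq_zero_of_notMem_vars {σ R : Type*} [CommSemiring R] {f : MvPolynomial σ R}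
    {v : σ} (h : v ∉ f.vars) : f.degreeOf v = 0 := by
  by_contra h'
  exact h (degreeOf_pos_iff_mem_vars.mp (Nat.pos_of_ne_zero h'))

theorem exists_isLeader (r : Ranking l) {f : DPoly l k} (hf : ¬ IsConst f) :
    ∃ u, IsLeader r f u := by
  have hne : f.vars.Nonempty := by
    rw [Finset.nonempty_iff_ne_empty]
    exact fun h => hf ⟨_, (vars_eq_empty_iff_eq_C).mp h⟩
  have key : ∀ s : Finset (DVar l), s.Nonempty → ∃ u ∈ s, ∀ v ∈ s, r.le v u := by
    intro s hs
    induction hs using Finset.Nonempty.cons_induction with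
    | singleton a => exact ⟨a, by simp, fun v hv => by simp at hv; exact hv ▸ r.le_refl a⟩
    | cons a s ha hs ih =>
      obtain ⟨u, hu, hmax⟩ := ih
      rcases r.le_total a u with h | h
      · refine ⟨u, by simp [hu], fun v hv => ?_⟩
        rcases Finset.mem_cons.mp hv with rfl | hv
        · exact h
        · exact hmax v hv
      · refine ⟨a, by simp, fun v hv => ?_⟩
        rcases Finset.mem_cons.mp hv with rfl | hv
        · exact r.le_refl v
        · exact r.le_trans _ _ _ (hmax v hv) h
  exact key f.vars hne

theorem rankLT_iff {f g : DPoly l k} {u v : DVar l} (hu : IsLeader r f u) (hv : IsLeader r g v) :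
    RankLT r f g ↔ r.lt u v ∨ (u = v ∧ f.degreeOf v < g.degreeOf v) := by
  constructor
  · rintro ⟨u', v', hu', hv', h⟩
    obtain rfl := hu.unique hu'
    obtain rfl := hv.unique hv'
    exact h
  · exact fun h => ⟨u, v, hu, hv, h⟩

theorem RankEq.trans {f g h : DPoly l k} (hfg : RankEq r f g) (hgh : RankEq r g h) :
    RankEq r f h := by
  obtain ⟨u, hu, hv, e⟩ := hfg
  obtain ⟨v, hv', hw, e'⟩ := hgh
  obtain rfl := hv.unique hv'
  exact ⟨u, hu, hw, e.trans e'⟩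

theorem RankLT.trans_rankEq {f g h : DPoly l k} (hfg : RankLT r f g) (hgh : RankEq r g h) :
    RankLT r f h := by
  obtain ⟨u, v, hu, hv, e⟩ := hfg
  obtain ⟨v', hv', hw, e'⟩ := hgh
  obtain rfl := hv.unique hv'
  exact ⟨u, v, hu, hw, e' ▸ e⟩

theorem rankEq_refl {f : DPoly l k} (hf : ¬ IsConst f) : RankEq r f f := by
  obtain ⟨u, hu⟩ := exists_isLeader r hf
  exact ⟨u, hu, hu, rfl⟩

open Classical in
/-- The rank of a differential polynomial (a junk value if it is constant). -/
noncomputable def polyRank (r : Ranking l) (f : DPoly l k) : Ordinal.{0} ×ₗ ℕ :=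
  if h : ∃ u, IsLeader r f u then toLex (r.position h.choose, f.degreeOf h.choose) else
    toLex (0, 0)

theorem IsLeader.polyRank_eq {f : DPoly l k} {u : DVar l} (hu : IsLeader r f u) :
    polyRank r f = toLex (r.position u, f.degreeOf u) := by
  have h : ∃ u, IsLeader r f u := ⟨u, hu⟩
  rw [polyRank, dif_pos h, h.choose_spec.unique hu]

theorem RankLT.polyRank_lt {f g : DPoly l k} (h : RankLT r f g) :
    polyRank r f < polyRank r g := by
  obtain ⟨u, v, hu, hv, h⟩ := h
  rw [hu.polyRank_eq, hv.polyRank_eq, Prod.Lex.toLex_lt_toLex]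
  rcases h with h | ⟨rfl, h⟩
  · exact Or.inl (Ranking.position_lt h)
  · exact Or.inr ⟨rfl, h⟩

theorem RankEq.polyRank_eq {f g : DPoly l k} (h : RankEq r f g) :
    polyRank r f = polyRank r g := by
  obtain ⟨u, hu, hv, h⟩ := h
  rw [hu.polyRank_eq, hv.polyRank_eq, h]

end Leader

/-! ### Autoreduced sets and existence of characteristic sets -/

section Autoreduced

variable {k : Type*} [CommRing k] {l : ℕ} {r : Ranking l} {p : ℕ}

/-- An autoreduced family in increasing order of rank, with its leaders `u`. -/
structure IsAutoreducedWith (r : Ranking l) (A : Fin p → DPoly l k) (u : Fin p → DVar l) :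
    Prop where
  leader : ∀ i, IsLeader r (A i) (u i)
  lt : ∀ i j, i < j → r.lt (u i) (u j)
  derivative_notMem : ∀ i j, i < j → ∀ n, 0 < n → ((u i).1, (u i).2 + n) ∉ (A j).vars
  degreeOf_lt : ∀ i j, i < j → (A j).degreeOf (u i) < (A i).degreeOf (u i)

/-- Two members with the same leader would each have smaller degree in it than the other, so the
leaders strictly increase. An earlier member then contains neither a later leader nor its
derivatives, and only reducedness of later members with respect to earlier ones carries information.
-/
theorem isAutoreducedSeq_iff {A : Fin p → DPoly l k} :
    IsAutoreducedSeq r A ↔ ∃ u, IsAutoreducedWith r A u := by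
  constructor
  · rintro ⟨⟨hc, hred⟩, hlt⟩
    have hex : ∀ i, ∃ u, IsLeader r (A i) u := fun i => exists_isLeader r (hc _ ⟨i, rfl⟩)
    choose u hu using hex
    have hne : ∀ i j, i < j → A i ≠ A j := fun i j hij h => by
      have := (hlt i j hij).polyRank_lt
      rw [h] at this
      exact this.false
    have h1 : ∀ i j, i < j → IsReduced r (A j) (A i) := fun i j hij =>
      hred _ ⟨j, rfl⟩ _ ⟨i, rfl⟩ (hne i j hij).symm
    have h2 : ∀ i j, i < j → IsReduced r (A i) (A j) := fun i j hij =>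
      hred _ ⟨i, rfl⟩ _ ⟨j, rfl⟩ (hne i j hij)
    refine ⟨u, hu, fun i j hij => ?_, fun i j hij => (h1 i j hij _ (hu i)).1,
      fun i j hij => (h1 i j hij _ (hu i)).2⟩
    rcases (rankLT_iff (hu i) (hu j)).mp (hlt i j hij) with h | ⟨h, -⟩
    · exact h
    · have h3 := (h1 i j hij _ (hu i)).2
      have h4 := (h2 i j hij _ (hu j)).2
      rw [h] at h3
      exact absurd h3 h4.asymm
  · rintro ⟨u, h⟩
    refine ⟨⟨?_, ?_⟩, fun i j hij => (rankLT_iff (h.leader i) (h.leader j)).mpr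
      (Or.inl (h.lt i j hij))⟩
    · rintro _ ⟨i, rfl⟩
      exact (h.leader i).not_isConst
    · rintro _ ⟨i, rfl⟩ _ ⟨j, rfl⟩ hne v hv
      obtain rfl := (h.leader j).unique hv
      rcases lt_trichotomy i j with hij | hij | hij
      · refine ⟨fun n hn => (h.leader i).notMem_vars_of_lt
          (Ranking.lt_trans (h.lt i j hij) (Ranking.lt_derivative _ hn)), ?_⟩
        rw [degreeOf_eq_zero_of_notMem_vars ((h.leader i).notMem_vars_of_lt (h.lt i j hij))]
        exact hv.degreeOf_pos
      · exact absurd (congrArg A hij) hne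
      · exact ⟨h.derivative_notMem j i hij, h.degreeOf_lt j i hij⟩

/-- Leaders in the same indeterminate are derivatives of one another. The larger belongs to the
later member, which would contain a proper derivative of an earlier leader. This bounds the length
by `l`. -/
theorem IsAutoreducedWith.fst_injective {A : Fin p → DPoly l k} {u : Fin p → DVar l}
    (h : IsAutoreducedWith r A u) : Function.Injective fun i => (u i).1 := by
  have key : ∀ i j, i < j → (u i).1 ≠ (u j).1 := fun i j hij e => by
    rcases lt_trichotomy (u i).2 (u j).2 with h1 | h1 | h1
    · refine h.derivative_notMem i j hij ((u j).2 - (u i).2) (by omega) ?_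
      rw [Nat.add_sub_cancel' h1.le, e]
      exact (h.leader j).1
    · exact (h.lt i j hij).2 (Prod.ext e h1)
    · have h2 := Ranking.lt_derivative (r := r) (u j) (n := (u i).2 - (u j).2) (by omega)
      rw [Nat.add_sub_cancel' h1.le, ← e] at h2
      exact Ranking.lt_irrefl _ (Ranking.lt_trans (h.lt i j hij) h2)
  intro i j e
  rcases lt_trichotomy i j with hij | hij | hij
  · exact absurd e (key i j hij)
  · exact hij
  · exact absurd e.symm (key j i hij)

theorem IsAutoreducedSeq.length_le {A : Fin p → DPoly l k} (h : IsAutoreducedSeq r A) : p ≤ l := by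
  obtain ⟨u, hu⟩ := isAutoreducedSeq_iff.mp h
  simpa using Fintype.card_le_of_injective _ hu.fst_injective

/-- The ranks of the members of a family of length at most `l`, padded by `⊤`. -/
noncomputable def seqRank (r : Ranking l) (A : Fin p → DPoly l k) :
    Fin l → WithTop (Ordinal.{0} ×ₗ ℕ) :=
  fun n => if h : n.val < p then (polyRank r (A ⟨n, h⟩) : WithTop _) else ⊤

/-- The padding by `⊤` makes a proper extension smaller, as the definition of lower rank demands. -/
theorem SeqRankLT.seqRank_lt {q : ℕ} {A : Fin p → DPoly l k} {B : Fin q → DPoly l k}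
    (h : SeqRankLT r A B) (hp : p ≤ l) : toLex (seqRank r A) < toLex (seqRank r B) := by
  rcases h with ⟨n, hnp, hnq, heq, hlt⟩ | ⟨hqp, heq⟩
  · refine ⟨⟨n, hnp.trans_le hp⟩, fun j hj => ?_, ?_⟩
    · have hj' : j.val < n := hj
      change seqRank r A j = seqRank r B j
      simp [seqRank, hj'.trans hnp, hj'.trans hnq, (heq j hj').polyRank_eq]
    · change seqRank r A _ < seqRank r B _
      simp [seqRank, hnp, hnq, hlt.polyRank_lt]
  · refine ⟨⟨q, hqp.trans_le hp⟩, fun j hj => ?_, ?_⟩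
    · have hj' : j.val < q := hj
      change seqRank r A j = seqRank r B j
      simp [seqRank, hj'.trans hqp, hj', (heq j hj').polyRank_eq]
    · change seqRank r A _ < seqRank r B _
      simp [seqRank, hqp]

/-- Rank sequences live in `Fin l → WithTop (Ordinal ×ₗ ℕ)`, whose lexicographic order is
well-founded because the length is fixed. The empty set is a candidate. -/
theorem exists_isCharacteristicSeq (r : Ranking l) (I : Ideal (DPoly l k)) :
    ∃ (p : ℕ) (A : Fin p → DPoly l k), IsCharacteristicSeq r I A := by
  let T := Σ p : ℕ, Fin p → DPoly l k
  let S : Set T := {A | IsAutoreducedSeq r A.2 ∧ ∀ i, A.2 i ∈ I}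
  have hS : S.Nonempty := by
    refine ⟨⟨0, Fin.elim0⟩, ?_, fun i => i.elim0⟩
    exact isAutoreducedSeq_iff.mpr ⟨Fin.elim0, fun i => i.elim0, fun i => i.elim0,
      fun i => i.elim0, fun i => i.elim0⟩
  have wf : WellFounded fun A B : T => toLex (seqRank r A.2) < toLex (seqRank r B.2) :=
    InvImage.wf (fun A : T => toLex (seqRank r A.2)) wellFounded_lt
  obtain ⟨⟨p, A⟩, ⟨hA, hI⟩, hmin⟩ := wf.has_min S hS
  exact ⟨p, A, hA, hI, fun q B hB hBI h => hmin ⟨q, B⟩ ⟨hB, hBI⟩ (h.seqRank_lt hB.length_le)⟩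

end Autoreduced

/-! ### Partial derivatives and degrees -/

section PDeriv

variable {σ R : Type*} [CommRing R]

theorem add_single_mem_support_of_mem_support_pderiv {f : MvPolynomial σ R} {v : σ} {m : σ →₀ ℕ}
    (hm : m ∈ (pderiv v f).support) : m + Finsupp.single v 1 ∈ f.support := by
  classical
  rw [mem_support_iff, coeff_pderiv] at hm
  rw [mem_support_iff]
  intro h
  simp [h] at hm

/-- Multiplying a monomial of the derivative by `v` gives a monomial of `f`. Without `h` the bound
could fail, since 0 has weighted degree 0. -/
theorem weightedTotalDegree_pderiv_add_le (w : σ → ℕ) {f : MvPolynomial σ R} {v : σ}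
    (h : pderiv v f ≠ 0) :
    weightedTotalDegree w (pderiv v f) + w v ≤ weightedTotalDegree w f := by
  have key : ∀ m ∈ (pderiv v f).support,
      Finsupp.weight w m + w v ≤ weightedTotalDegree w f := fun m hm => by
    have := le_weightedTotalDegree w (add_single_mem_support_of_mem_support_pderiv hm)
    rwa [map_add, Finsupp.weight_single, one_smul] at this
  obtain ⟨m, hm⟩ := support_nonempty.mpr h
  have h1 := key m hm
  have h2 : weightedTotalDegree w (pderiv v f) ≤ weightedTotalDegree w f - w v :=
    weightedTotalDegree_le_iff.mpr fun m hm => by have := key m hm; omega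
  omega

theorem degreeOf_pderiv_le (z : σ) {f : MvPolynomial σ R} {v : σ} (h : pderiv v f ≠ 0) :
    (pderiv v f).degreeOf z ≤ f.degreeOf z := by
  classical
  have := weightedTotalDegree_pderiv_add_le (Pi.single z 1) h
  rw [weightedTotalDegree_piSingle, weightedTotalDegree_piSingle] at this
  omega

theorem pderiv_ne_zero_of_mem_vars [IsDomain R] [CharZero R] {f : MvPolynomial σ R} {v : σ}
    (h : v ∈ f.vars) : pderiv v f ≠ 0 := by
  classical
  obtain ⟨m, hm, hv⟩ := (mem_vars_iff_mem_support v).mp h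
  intro h0
  have h1 := coeff_pderiv (i := v) f (m - Finsupp.single v 1)
  have hle : Finsupp.single v 1 ≤ m := by
    rw [Finsupp.single_le_iff]
    exact Nat.one_le_iff_ne_zero.mpr (Finsupp.mem_support_iff.mp hv)
  rw [h0, coeff_zero, tsub_add_cancel_of_le hle] at h1
  have h2 : ((m - Finsupp.single v 1 : σ →₀ ℕ) v : R) + 1 ≠ 0 := Nat.cast_add_one_ne_zero _
  have h3 := mem_support_iff.mp hm
  exact mul_ne_zero h3 h2 h1.symm

theorem vars_subset_of_degreeOf_le {f g : MvPolynomial σ R}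
    (h : ∀ v, f.degreeOf v ≤ g.degreeOf v) : f.vars ⊆ g.vars := fun v hv =>
  degreeOf_pos_iff_mem_vars.mp ((degreeOf_pos_iff_mem_vars.mpr hv).trans_le (h v))

end PDeriv

/-! ### Exchange principle and minimal characteristic sets -/

section Characteristic

variable {k : Type*} [Field k] {l : ℕ} {r : Ranking l} {P : Ideal (DPoly l k)} {p : ℕ}
  {A : Fin p → DPoly l k} {u : Fin p → DVar l}

/-- `f` is reduced with respect to the members of `A` before the `i`-th one, and its variables do
not exceed the leader of `A i`. -/
structure IsReducedBelow (r : Ranking l) (A : Fin p → DPoly l k) (u : Fin p → DVar l) (i : Fin p)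
    (f : DPoly l k) : Prop where
  le : ∀ v ∈ f.vars, r.le v (u i)
  derivative_notMem : ∀ j < i, ∀ n, 0 < n → ((u j).1, (u j).2 + n) ∉ f.vars
  degreeOf_lt : ∀ j < i, f.degreeOf (u j) < (A j).degreeOf (u j)

theorem IsAutoreducedWith.isReducedBelow (hA : IsAutoreducedWith r A u) (i : Fin p) :
    IsReducedBelow r A u i (A i) where
  le := (hA.leader i).2
  derivative_notMem j hj := hA.derivative_notMem j i hj
  degreeOf_lt j hj := hA.degreeOf_lt j i hj

theorem IsReducedBelow.mono {i : Fin p} {f g : DPoly l k} (hg : IsReducedBelow r A u i g)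
    (h : ∀ v, f.degreeOf v ≤ g.degreeOf v) : IsReducedBelow r A u i f where
  le v hv := hg.le v (vars_subset_of_degreeOf_le h hv)
  derivative_notMem j hj n hn hv :=
    hg.derivative_notMem j hj n hn (vars_subset_of_degreeOf_le h hv)
  degreeOf_lt j hj := (h _).trans_lt (hg.degreeOf_lt j hj)

/-- An element of `P` which could precede `A i` in an autoreduced set vanishes. -/
theorem IsCharacteristicSeq.eq_zero_of_isReducedBelow (hC : IsCharacteristicSeq r P A)
    (hA : IsAutoreducedWith r A u) (hP : P ≠ ⊤) {i : Fin p} {f : DPoly l k} (hf : f ∈ P)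
    (hred : IsReducedBelow r A u i f) (hdeg : f.degreeOf (u i) < (A i).degreeOf (u i)) :
    f = 0 := by
  classical
  by_contra hf0
  have hconst : ¬ IsConst f := by
    rintro ⟨a, rfl⟩
    have ha : a ≠ 0 := fun h => hf0 (by rw [h, C_0])
    exact hP (Ideal.eq_top_of_isUnit_mem _ hf ((isUnit_iff_ne_zero.mpr ha).map C))
  obtain ⟨v, hv⟩ := exists_isLeader r hconst
  -- Take the first `A n` of higher rank than `f`. The sequence consisting of the members before `A
  -- n`, followed by `f`, will be autoreduced and of lower rank than `A`.
  have hex : ∃ n, ∃ h : n < p, RankLT r f (A ⟨n, h⟩) := by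
    refine ⟨i.val, i.isLt, (rankLT_iff hv (hA.leader i)).mpr ?_⟩
    rcases Ranking.lt_or_eq_of_le (hred.le v hv.1) with h | h
    · exact Or.inl h
    · exact Or.inr ⟨h, hdeg⟩
  obtain ⟨hn, hlt⟩ := Nat.find_spec hex
  have hmin : ∀ m, m < Nat.find hex → ∀ h : m < p, ¬ RankLT r f (A ⟨m, h⟩) :=
    fun m hm h h' => Nat.find_min hex hm ⟨h, h'⟩
  have hni : Nat.find hex ≤ i.val := Nat.find_min' hex <| by
    refine ⟨i.isLt, (rankLT_iff hv (hA.leader i)).mpr ?_⟩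
    rcases Ranking.lt_or_eq_of_le (hred.le v hv.1) with h | h
    · exact Or.inl h
    · exact Or.inr ⟨h, hdeg⟩
  generalize Nat.find hex = n at hn hlt hmin hni
  -- By minimality of `n`, `f` does not have lower rank than `A j`. Since its degree in `u j` is
  -- smaller, its leader must lie strictly above `u j`.
  have hbelow : ∀ j : Fin p, j.val < n → r.lt (u j) v := fun j hj => by
    have hj' : j < i := Fin.lt_def.mpr (hj.trans_le hni)
    have h1 := hmin j.val hj j.isLt
    rw [rankLT_iff hv (hA.leader j)] at h1
    rcases Ranking.lt_trichotomy (r := r) (u j) v with h | h | h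
    · exact h
    · exact absurd (Or.inr ⟨h.symm, hred.degreeOf_lt j hj'⟩) h1
    · exact absurd (Or.inl h) h1
  let B : Fin (n + 1) → DPoly l k := fun j => if h : j.val < n then A ⟨j, h.trans hn⟩ else f
  let u' : Fin (n + 1) → DVar l := fun j => if h : j.val < n then u ⟨j, h.trans hn⟩ else v
  have hB : IsAutoreducedWith r B u' := by
    constructor
    · intro j
      by_cases h : j.val < n
      · simp only [B, u', h, dif_pos]; exact hA.leader _
      · simp only [B, u', h, dif_neg, not_false_eq_true]; exact hv
    · intro a b hab
      have ha : a.val < n := by have := Fin.lt_def.mp hab; omega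
      by_cases hb : b.val < n
      · simp only [u', ha, hb, dif_pos]
        exact hA.lt _ _ hab
      · simp only [u', ha, hb, dif_pos, dif_neg, not_false_eq_true]
        exact hbelow _ ha
    · intro a b hab
      have ha : a.val < n := by have := Fin.lt_def.mp hab; omega
      by_cases hb : b.val < n
      · simp only [B, u', ha, hb, dif_pos]
        exact hA.derivative_notMem _ _ hab
      · simp only [B, u', ha, hb, dif_pos, dif_neg, not_false_eq_true]
        exact hred.derivative_notMem _ (Fin.lt_def.mpr (ha.trans_le hni))
    · intro a b hab
      have ha : a.val < n := by have := Fin.lt_def.mp hab; omega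
      by_cases hb : b.val < n
      · simp only [B, u', ha, hb, dif_pos]
        exact hA.degreeOf_lt _ _ hab
      · simp only [B, u', ha, hb, dif_pos, dif_neg, not_false_eq_true]
        exact hred.degreeOf_lt _ (Fin.lt_def.mpr (ha.trans_le hni))
  refine hC.2.2 (n + 1) B (isAutoreducedSeq_iff.mpr ⟨u', hB⟩) (fun j => ?_)
    (Or.inl ⟨n, Nat.lt_succ_self n, hn, fun m hm => ?_, ?_⟩)
  · by_cases h : j.val < n
    · simp only [B, h, dif_pos]; exact hC.2.1 _
    · simp only [B, h, dif_neg, not_false_eq_true]; exact hf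
  · simp only [B, hm, dif_pos]
    exact rankEq_refl (hA.leader _).not_isConst
  · simp only [B, lt_irrefl, dif_neg, not_false_eq_true]
    exact hlt

theorem IsCharacteristicSeq.degreeOf_eq (hC : IsCharacteristicSeq r P A)
    (hA : IsAutoreducedWith r A u) (hP : P ≠ ⊤) {i : Fin p} {f : DPoly l k} (hf : f ∈ P)
    (hf0 : f ≠ 0) (hred : IsReducedBelow r A u i f)
    (hdeg : f.degreeOf (u i) ≤ (A i).degreeOf (u i)) :
    f.degreeOf (u i) = (A i).degreeOf (u i) := by
  by_contra h
  exact hf0 (hC.eq_zero_of_isReducedBelow hA hP hf hred (lt_of_le_of_ne hdeg h))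

/-- A nonzero element of `P` of at most the rank of `A i` can replace `A i`. -/
theorem IsCharacteristicSeq.update (hC : IsCharacteristicSeq r P A)
    (hA : IsAutoreducedWith r A u) (hP : P ≠ ⊤) {i : Fin p} {f : DPoly l k} (hf : f ∈ P)
    (hf0 : f ≠ 0) (hred : IsReducedBelow r A u i f)
    (hdeg : f.degreeOf (u i) ≤ (A i).degreeOf (u i)) :
    IsCharacteristicSeq r P (Function.update A i f) := by
  have hd := hC.degreeOf_eq hA hP hf hf0 hred hdeg
  have hl : IsLeader r f (u i) :=
    ⟨degreeOf_pos_iff_mem_vars.mp (hd ▸ (hA.leader i).degreeOf_pos), hred.le⟩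
  have hlead : ∀ j, IsLeader r (Function.update A i f j) (u j) := fun j => by
    rcases eq_or_ne j i with rfl | hj
    · rwa [Function.update_self]
    · rw [Function.update_of_ne hj]; exact hA.leader j
  have hdeg' : ∀ j, (Function.update A i f j).degreeOf (u j) = (A j).degreeOf (u j) := fun j => by
    rcases eq_or_ne j i with rfl | hj
    · rwa [Function.update_self]
    · rw [Function.update_of_ne hj]
  have hB : IsAutoreducedWith r (Function.update A i f) u := by
    refine ⟨hlead, hA.lt, fun a b hab => ?_, fun a b hab => ?_⟩
    · rcases eq_or_ne b i with rfl | hb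
      · rw [Function.update_self]; exact hred.derivative_notMem a hab
      · rw [Function.update_of_ne hb]; exact hA.derivative_notMem a b hab
    -- Reducedness with respect to a member depends only on its leader and its degree there, so
    -- members after `A i` stay reduced.
    · rw [hdeg']
      rcases eq_or_ne b i with rfl | hb
      · rw [Function.update_self]; exact hred.degreeOf_lt a hab
      · rw [Function.update_of_ne hb]; exact hA.degreeOf_lt a b hab
  -- All ranks are unchanged, so a set lower than the new one would be lower than `A`.
  have hrank : ∀ j, RankEq r (Function.update A i f j) (A j) := fun j =>
    ⟨u j, hlead j, hA.leader j, hdeg' j⟩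
  refine ⟨isAutoreducedSeq_iff.mpr ⟨u, hB⟩, fun j => ?_, fun q D hD hDP h => ?_⟩
  · rcases eq_or_ne j i with rfl | hj
    · rwa [Function.update_self]
    · rw [Function.update_of_ne hj]; exact hC.2.1 j
  · refine hC.2.2 q D hD hDP ?_
    rcases h with ⟨n, hq, hp, heq, hlt⟩ | ⟨hpq, heq⟩
    · exact Or.inl ⟨n, hq, hp, fun m hm => (heq m hm).trans (hrank _), hlt.trans_rankEq (hrank _)⟩
    · exact Or.inr ⟨hpq, fun m hm => (heq m hm).trans (hrank _)⟩

/-- No degree of the initial exceeds that of `A i`, so it inherits reducedness. It is free of `u i`,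
and in `P` it would have to vanish. -/
theorem IsCharacteristicSeq.leadingCoeffIn_notMem (hC : IsCharacteristicSeq r P A)
    (hA : IsAutoreducedWith r A u) (hP : P ≠ ⊤) (i : Fin p) :
    leadingCoeffIn (u i) (A i) ∉ P := fun h => by
  have hpos := (hA.leader i).degreeOf_pos
  refine leadingCoeffIn_ne_zero hpos (hC.eq_zero_of_isReducedBelow hA hP h
    ((hA.isReducedBelow i).mono fun v => degreeOf_leadingCoeffIn_le v _ _) ?_)
  rw [degreeOf_leadingCoeffIn_self]
  exact hpos

open Classical in
/-- The weight function counting the variables that do not appear before `A i`. -/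
noncomputable def newWeight (A : Fin p → DPoly l k) (i : Fin p) (v : DVar l) : ℕ :=
  if v ∈ prevVars A i then 0 else 1

theorem newWeight_of_mem {i : Fin p} {v : DVar l} (h : v ∈ prevVars A i) : newWeight A i v = 0 :=
  if_pos h

theorem newWeight_of_notMem {i : Fin p} {v : DVar l} (h : v ∉ prevVars A i) :
    newWeight A i v = 1 :=
  if_neg h

theorem newWeight_update {i j : Fin p} (hj : j ≤ i) (f : DPoly l k) :
    newWeight (Function.update A i f) j = newWeight A j := by
  have hprev : prevVars (Function.update A i f) j = prevVars A j := by
    ext v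
    refine exists_congr fun a => and_congr_right fun ha => ?_
    rw [Function.update_of_ne (ha.trans_le hj).ne]
  funext v
  by_cases h : v ∈ prevVars A j
  · rw [newWeight_of_mem h, newWeight_of_mem (hprev ▸ h)]
  · rw [newWeight_of_notMem h, newWeight_of_notMem (hprev ▸ h)]

/-- The total degrees of the `A i` in the variables that do not appear before. -/
noncomputable def newDegree (A : Fin p → DPoly l k) (i : Fin p) : ℕ :=
  weightedTotalDegree (newWeight A i) (A i)

/-- A characteristic set whose members have lexicographically minimal degrees in their new
variables. -/
def IsMinimalCharacteristicSeq (r : Ranking l) (P : Ideal (DPoly l k)) (A : Fin p → DPoly l k) :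
    Prop :=
  IsCharacteristicSeq r P A ∧
    ∀ B : Fin p → DPoly l k, IsCharacteristicSeq r P B →
      ¬ toLex (newDegree B) < toLex (newDegree A)

/-- The length `p` is fixed by a first choice, so the degree sequences lie in the well-founded
lexicographic order on `Fin p → ℕ`. -/
theorem exists_isMinimalCharacteristicSeq (r : Ranking l) (P : Ideal (DPoly l k)) :
    ∃ (p : ℕ) (A : Fin p → DPoly l k), IsMinimalCharacteristicSeq r P A := by
  obtain ⟨p, A, hA⟩ := exists_isCharacteristicSeq r P
  have wf : WellFounded fun B D : Fin p → DPoly l k => toLex (newDegree B) < toLex (newDegree D) :=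
    InvImage.wf (fun B : Fin p → DPoly l k => toLex (newDegree B)) wellFounded_lt
  obtain ⟨B, hB, hmin⟩ := wf.has_min {B | IsCharacteristicSeq r P B} ⟨A, hA⟩
  exact ⟨p, B, hB, fun D hD => hmin D hD⟩

/-- Replacing `A i` by `f` leaves the earlier degrees unchanged. Later ones may grow, which the
lexicographic order ignores. -/
theorem IsMinimalCharacteristicSeq.newDegree_le (hC : IsMinimalCharacteristicSeq r P A)
    (hA : IsAutoreducedWith r A u) (hP : P ≠ ⊤) {i : Fin p} {f : DPoly l k} (hf : f ∈ P)
    (hf0 : f ≠ 0) (hred : IsReducedBelow r A u i f)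
    (hdeg : f.degreeOf (u i) ≤ (A i).degreeOf (u i)) :
    newDegree A i ≤ weightedTotalDegree (newWeight A i) f := by
  by_contra hlt
  refine hC.2 _ (hC.1.update hA hP hf hf0 hred hdeg) ⟨i, fun j hj => ?_, ?_⟩
  · change newDegree _ j = newDegree _ j
    rw [newDegree, newDegree, newWeight_update (le_of_lt hj), Function.update_of_ne (ne_of_lt hj)]
  · change newDegree _ i < newDegree _ i
    rw [newDegree, newWeight_update le_rfl, Function.update_self]
    exact not_le.mp hlt

/-- The derivative could replace `A i` in a characteristic set, but its degree in the new variables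
is smaller. -/
theorem IsMinimalCharacteristicSeq.pderiv_notMem [CharZero k]
    (hC : IsMinimalCharacteristicSeq r P A) (hP : P ≠ ⊤) {i : Fin p} {v : DVar l}
    (hv : v ∈ (A i).vars) (hnew : v ∉ prevVars A i) : pderiv v (A i) ∉ P := fun hmem => by
  obtain ⟨u, hA⟩ := isAutoreducedSeq_iff.mp hC.1.1
  have h0 : pderiv v (A i) ≠ 0 := pderiv_ne_zero_of_mem_vars hv
  have h1 := hC.newDegree_le hA hP hmem h0
    ((hA.isReducedBelow i).mono fun z => degreeOf_pderiv_le z h0) (degreeOf_pderiv_le _ h0)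
  have h2 := weightedTotalDegree_pderiv_add_le (newWeight A i) h0
  rw [newWeight_of_notMem hnew] at h2
  exact absurd h2 (by rw [not_le]; exact Nat.lt_succ_of_le h1)

end Characteristic

/-! ### Passing to `Quot(k[V]/J)[U]` and back -/

section Fraction

variable {σ k : Type*} [Field k]

/-- A polynomial over `Quot(R/J)` can be lifted to `R` after multiplication by a denominator. -/
theorem exists_lift_fractionRing {R : Type*} [CommRing R] (J : Ideal R) [J.IsPrime]
    (f : MvPolynomial σ (FractionRing (R ⧸ J))) :
    ∃ a ∉ J, ∃ b : MvPolynomial σ R,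
      map ((algebraMap (R ⧸ J) (FractionRing (R ⧸ J))).comp (Ideal.Quotient.mk J)) b =
          C (algebraMap (R ⧸ J) (FractionRing (R ⧸ J)) (Ideal.Quotient.mk J a)) * f ∧
        ∀ w : σ → ℕ, weightedTotalDegree w b ≤ weightedTotalDegree w f := by
  classical
  obtain ⟨⟨s, hs⟩, h⟩ := IsLocalization.exist_integer_multiples (nonZeroDivisors (R ⧸ J))
    f.support (fun m => coeff m f)
  obtain ⟨a, rfl⟩ := Ideal.Quotient.mk_surjective s
  have h' : ∀ m, ∃ c : R, m ∈ f.support →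
      algebraMap (R ⧸ J) (FractionRing (R ⧸ J)) (Ideal.Quotient.mk J c) =
        algebraMap (R ⧸ J) (FractionRing (R ⧸ J)) (Ideal.Quotient.mk J a) * coeff m f := by
    intro m
    by_cases hm : m ∈ f.support
    · obtain ⟨d, hd⟩ := h m hm
      obtain ⟨c, rfl⟩ := Ideal.Quotient.mk_surjective d
      refine ⟨c, fun _ => hd.trans ?_⟩
      exact Algebra.smul_def _ _
    · exact ⟨0, fun hm' => absurd hm' hm⟩
  choose c hc using h'
  refine ⟨a, fun ha => ?_, ∑ m ∈ f.support, monomial m (c m), ?_, fun w => ?_⟩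
  · rw [Ideal.Quotient.eq_zero_iff_mem.mpr ha] at hs
    exact zero_notMem_nonZeroDivisors hs
  · rw [map_sum]
    conv_rhs => rw [f.as_sum, Finset.mul_sum]
    refine Finset.sum_congr rfl fun m hm => ?_
    rw [map_monomial, C_mul_monomial, RingHom.comp_apply, hc m hm]
  · refine weightedTotalDegree_sum_le _ _ fun m hm => weightedTotalDegree_le_iff.mpr fun n hn => ?_
    rw [Finset.mem_singleton.mp (support_monomial_subset hn)]
    exact le_weightedTotalDegree w hm

theorem rename_killCompl_of_vars_subset {V : Set σ} {f : MvPolynomial σ k}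
    (h : ∀ v ∈ f.vars, v ∈ V) :
    rename Subtype.val (killCompl (Subtype.val_injective (p := (· ∈ V))) f) = f := by
  have hf : f ∈ supported k V := mem_supported.mpr h
  rw [supported_eq_range_rename] at hf
  obtain ⟨g, rfl⟩ := hf
  exact congrArg (rename Subtype.val) (killCompl_rename_app _ g)

variable (V U : Set σ) (J : Ideal (MvPolynomial V k))

/-- The map from `k[V]` to `Quot(k[V]/J)`. -/
noncomputable def toFrac : MvPolynomial V k →+* FractionRing (MvPolynomial V k ⧸ J) :=
  (algebraMap (MvPolynomial V k ⧸ J) (FractionRing (MvPolynomial V k ⧸ J))).comp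
    (Ideal.Quotient.mk J)

open Classical in
/-- The map to `Quot(k[V]/J)[U]` which kills the variables outside `V ∪ U`. -/
noncomputable def fracHom :
    MvPolynomial σ k →+* MvPolynomial U (FractionRing (MvPolynomial V k ⧸ J)) :=
  eval₂Hom
    ((C : FractionRing (MvPolynomial V k ⧸ J) →+*
        MvPolynomial U (FractionRing (MvPolynomial V k ⧸ J))).comp
      ((algebraMap (MvPolynomial V k ⧸ J) (FractionRing (MvPolynomial V k ⧸ J))).comp
        ((Ideal.Quotient.mk J).comp C)))
    (fun v =>
      if hV : v ∈ V then
        C (algebraMap (MvPolynomial V k ⧸ J) (FractionRing (MvPolynomial V k ⧸ J))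
          (Ideal.Quotient.mk J (X ⟨v, hV⟩)))
      else if hU : v ∈ U then X ⟨v, hU⟩
      else 0)

/-- The map `k[V][U] → k[σ]`. -/
noncomputable def unpackHom : MvPolynomial U (MvPolynomial V k) →+* MvPolynomial σ k :=
  eval₂Hom (rename Subtype.val : MvPolynomial V k →ₐ[k] MvPolynomial σ k).toRingHom
    (fun v => X v.val)

variable {V U J}

theorem toFrac_eq_zero_iff [J.IsPrime] {a : MvPolynomial V k} : toFrac V J a = 0 ↔ a ∈ J := by
  rw [toFrac, RingHom.comp_apply,
    IsFractionRing.to_map_eq_zero_iff (K := FractionRing (MvPolynomial V k ⧸ J)),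
    Ideal.Quotient.eq_zero_iff_mem]

theorem fracHom_C (a : k) : fracHom V U J (C a) = C (toFrac V J (C a)) :=
  eval₂Hom_C _ _ _

theorem fracHom_X_of_mem {v : σ} (h : v ∈ V) :
    fracHom V U J (X v) = C (toFrac V J (X ⟨v, h⟩)) := by
  rw [fracHom, eval₂Hom_X', dif_pos h]
  rfl

theorem fracHom_X_of_notMem {v : σ} (h : v ∉ V) (h' : v ∈ U) :
    fracHom V U J (X v) = X ⟨v, h'⟩ := by
  rw [fracHom, eval₂Hom_X', dif_neg h, dif_pos h']

theorem fracHom_X_eq_zero {v : σ} (h : v ∉ V) (h' : v ∉ U) :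
    fracHom V U J (X v) = 0 := by
  rw [fracHom, eval₂Hom_X', dif_neg h, dif_neg h']

theorem fracHom_rename (a : MvPolynomial V k) :
    fracHom V U J (rename Subtype.val a) = C (toFrac V J a) := by
  have h : (fracHom V U J).comp
      (rename Subtype.val : MvPolynomial V k →ₐ[k] MvPolynomial σ k).toRingHom =
      (C : _ →+* MvPolynomial U (FractionRing (MvPolynomial V k ⧸ J))).comp (toFrac V J) := by
    refine ringHom_ext (fun b => ?_) (fun v => ?_)
    · simp only [RingHom.comp_apply, AlgHom.toRingHom_eq_coe, RingHom.coe_coe, rename_C, fracHom_C]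
    · simp only [RingHom.comp_apply, AlgHom.toRingHom_eq_coe, RingHom.coe_coe, rename_X]
      exact fracHom_X_of_mem v.2
  exact RingHom.congr_fun h a

theorem unpackHom_C (a : MvPolynomial V k) :
    unpackHom V U (C a) = rename Subtype.val a :=
  eval₂Hom_C _ _ _

theorem unpackHom_X (v : U) : unpackHom V U (X v : MvPolynomial U (MvPolynomial V k)) = X v.val :=
  eval₂Hom_X' _ _ _

/-- Disjointness matters: on a variable in both sets, `fracHom` would choose the coefficient in `V`.
-/
theorem fracHom_unpackHom (hUV : ∀ v ∈ U, v ∉ V) (b : MvPolynomial U (MvPolynomial V k)) :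
    fracHom V U J (unpackHom V U b) = map (toFrac V J) b := by
  have h : (fracHom V U J).comp (unpackHom V U) = map (toFrac V J) := by
    refine ringHom_ext (fun b => ?_) (fun v => ?_)
    · rw [RingHom.comp_apply, unpackHom_C, fracHom_rename, map_C]
    · rw [RingHom.comp_apply, unpackHom_X, fracHom_X_of_notMem (hUV _ v.2) v.2, map_X]
  exact RingHom.congr_fun h b

theorem exists_unpackHom_eq {f : MvPolynomial σ k} (h : ∀ v ∈ f.vars, v ∈ V ∨ v ∈ U) :
    ∃ b, unpackHom V U b = f := by
  classical
  let χ : MvPolynomial σ k →+* MvPolynomial U (MvPolynomial V k) :=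
    eval₂Hom (C.comp C) fun v =>
      if hV : v ∈ V then C (X ⟨v, hV⟩) else if hU : v ∈ U then X ⟨v, hU⟩ else 0
  refine ⟨χ f, ?_⟩
  have key : ((unpackHom V U).comp χ) f = (RingHom.id _) f := by
    refine hom_congr_vars (RingHom.ext fun a => ?_) (fun v hv _ => ?_) rfl
    · simp only [RingHom.comp_apply, RingHom.id_apply, χ, eval₂Hom_C, unpackHom_C, rename_C]
    · simp only [RingHom.comp_apply, RingHom.id_apply, χ, eval₂Hom_X']
      by_cases hV : v ∈ V
      · rw [dif_pos hV, unpackHom_C, rename_X]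
      · have hU := (h v hv).resolve_left hV
        rw [dif_neg hV, dif_pos hU, unpackHom_X]
  exact key

theorem weightedTotalDegree_unpackHom_le {w : σ → ℕ} (hw : ∀ v ∈ V, w v = 0)
    (b : MvPolynomial U (MvPolynomial V k)) :
    weightedTotalDegree w (unpackHom V U b) ≤ weightedTotalDegree (fun v : U => w v) b := by
  refine weightedTotalDegree_map_le _ (fun a => ?_) (fun v => ?_) b
  · rw [unpackHom_C]
    refine weightedTotalDegree_eq_zero_of_vars fun v hv => ?_
    obtain ⟨z, -, rfl⟩ := mem_vars_rename _ _ hv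
    exact hw _ z.2
  · rw [unpackHom_X]
    exact weightedTotalDegree_X_le _

theorem weightedTotalDegree_fracHom_le (w : σ → ℕ) (f : MvPolynomial σ k) :
    weightedTotalDegree (fun v : U => w v) (fracHom V U J f) ≤ weightedTotalDegree w f := by
  refine weightedTotalDegree_map_le _ (fun a => ?_) (fun v => ?_) f
  · rw [fracHom_C, weightedTotalDegree_C]
  · by_cases hV : v ∈ V
    · rw [fracHom_X_of_mem hV, weightedTotalDegree_C]
      exact Nat.zero_le _
    · by_cases hU : v ∈ U
      · rw [fracHom_X_of_notMem hV hU]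
        exact weightedTotalDegree_X_le _
      · rw [fracHom_X_eq_zero hV hU, weightedTotalDegree_zero]
        exact Nat.zero_le _

theorem degreeOf_fracHom_le (v : U) (f : MvPolynomial σ k) :
    degreeOf v (fracHom V U J f) ≤ degreeOf v.val f := by
  classical
  have h := weightedTotalDegree_fracHom_le (V := V) (U := U) (J := J) (Pi.single v.val 1) f
  have hw : (fun z : U => (Pi.single v.val 1 : σ → ℕ) z) = Pi.single v 1 := by
    funext z
    simp only [Pi.single_apply, Subtype.ext_iff]
  rwa [hw, weightedTotalDegree_piSingle, weightedTotalDegree_piSingle] at h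

/-- All coefficients lie in `J`, hence in `P` after renaming. -/
theorem unpackHom_mem [J.IsPrime] {P : Ideal (MvPolynomial σ k)}
    (hJ : ∀ g, g ∈ J → rename Subtype.val g ∈ P) {b : MvPolynomial U (MvPolynomial V k)}
    (h0 : map (toFrac V J) b = 0) : unpackHom V U b ∈ P := by
  have hb : ∀ m, coeff m b ∈ J := fun m => by
    rw [← toFrac_eq_zero_iff, ← coeff_map, h0, coeff_zero]
  rw [b.as_sum, map_sum]
  refine sum_mem fun m _ => ?_
  rw [monomial_eq, map_mul, unpackHom_C]
  exact P.mul_mem_right _ (hJ _ (hb m))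

/-- If `J = P ∩ k[V]`, then the kernel of `k[V ∪ U] → Quot(k[V]/J)[U]` is contained in `P`. -/
theorem mem_of_fracHom_eq_zero [J.IsPrime] (hUV : ∀ v ∈ U, v ∉ V) {P : Ideal (MvPolynomial σ k)}
    (hJ : ∀ g, g ∈ J → rename Subtype.val g ∈ P) {f : MvPolynomial σ k}
    (h : ∀ v ∈ f.vars, v ∈ V ∨ v ∈ U) (h0 : fracHom V U J f = 0) : f ∈ P := by
  obtain ⟨b, rfl⟩ := exists_unpackHom_eq h
  rw [fracHom_unpackHom hUV] at h0
  exact unpackHom_mem hJ h0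

theorem isUnit_of_totalDegree_eq_zero [J.IsPrime]
    {f : MvPolynomial U (FractionRing (MvPolynomial V k ⧸ J))} (hf : f ≠ 0)
    (h : f.totalDegree = 0) : IsUnit f := by
  rw [totalDegree_eq_zero_iff_eq_C] at h
  rw [h] at hf ⊢
  refine IsUnit.map C (isUnit_iff_ne_zero.mpr fun h0 => hf ?_)
  rw [h0, C_0]

end Fraction

/-! ### Primality of `J` and irreducibility of the members -/

section Irreducibility

variable {k : Type*} [Field k] {l : ℕ} {r : Ranking l} {P : Ideal (DPoly l k)} {p : ℕ}
  {A : Fin p → DPoly l k} {u : Fin p → DVar l}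

theorem IsAutoreducedWith.lt_of_mem_prevVars (hA : IsAutoreducedWith r A u) {i : Fin p}
    {v : DVar l} (hv : v ∈ prevVars A i) : r.lt v (u i) := by
  obtain ⟨j, hj, hv⟩ := hv
  exact Ranking.lt_of_le_of_lt ((hA.leader j).2 v hv) (hA.lt j i hj)

theorem IsAutoreducedWith.leader_notMem_prevVars (hA : IsAutoreducedWith r A u) (i : Fin p) :
    u i ∉ prevVars A i :=
  fun h => Ranking.lt_irrefl _ (hA.lt_of_mem_prevVars h)

theorem IsAutoreducedWith.leader_mem_newVars (hA : IsAutoreducedWith r A u) (i : Fin p) :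
    u i ∈ newVars A i :=
  ⟨(hA.leader i).1, hA.leader_notMem_prevVars i⟩

theorem IsAutoreducedWith.derivative_notMem_vars (hA : IsAutoreducedWith r A u) (i j : Fin p)
    {n : ℕ} (hn : 0 < n) : ((u i).1, (u i).2 + n) ∉ (A j).vars := by
  rcases lt_or_ge i j with h | h
  · exact hA.derivative_notMem i j h n hn
  · refine (hA.leader j).notMem_vars_of_lt (Ranking.lt_of_le_of_lt ?_ (Ranking.lt_derivative _ hn))
    rcases h.eq_or_lt with rfl | h
    · exact r.le_refl _
    · exact (hA.lt j i h).1

/-- No member contains a proper derivative of any leader. Among the variables of `V ∪ U`, algebraic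
reduction is therefore already differential reduction. -/
theorem IsAutoreducedWith.isReducedBelow_of_vars (hA : IsAutoreducedWith r A u) {i : Fin p}
    {f : DPoly l k} (hv : ∀ v ∈ f.vars, v ∈ prevVars A i ∨ v ∈ newVars A i)
    (hdeg : ∀ j < i, f.degreeOf (u j) < (A j).degreeOf (u j)) : IsReducedBelow r A u i f where
  le v h := (hv v h).elim (fun h => (hA.lt_of_mem_prevVars h).1) fun h => (hA.leader i).2 v h.1
  derivative_notMem j _ n hn h := by
    rcases hv _ h with ⟨m, -, h⟩ | h
    · exact hA.derivative_notMem_vars j m hn h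
    · exact hA.derivative_notMem_vars j i hn h.1
  degreeOf_lt := hdeg

theorem IsAutoreducedWith.exists_remainder_below (hA : IsAutoreducedWith r A u) (i : Fin p)
    (f : DPoly l k) (hv : ∀ v ∈ f.vars, v ∈ prevVars A i ∨ v ∈ newVars A i) :
    ∃ s ∈ Submonoid.closure {g | ∃ j < i, g = leadingCoeffIn (u j) (A j)},
      ∃ R : DPoly l k, s * f - R ∈ Ideal.span {g | ∃ j < i, g = A j} ∧
        IsReducedBelow r A u i R ∧
        ∀ w : DVar l → ℕ, (∀ v ∈ prevVars A i, w v = 0) →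
          weightedTotalDegree w R ≤ weightedTotalDegree w f := by
  classical
  obtain ⟨s, hs, R, h1, h2, h3⟩ := exists_remainder A u (fun i => (hA.leader i).1)
    (fun a b hab => (hA.leader a).notMem_vars_of_lt (hA.lt a b hab)) i.val f
  have hw : ∀ w : DVar l → ℕ, (∀ v ∈ prevVars A i, w v = 0) →
      weightedTotalDegree w R ≤ weightedTotalDegree w f := fun w hw =>
    h3 w fun j hj v hv => hw v ⟨j, hj, hv⟩
  refine ⟨s, hs, R, h1, hA.isReducedBelow_of_vars (fun v hvR => ?_) h2, hw⟩
  by_contra hvn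
  -- With the weight that counts `v` alone, the degree bound says that division introduces no
  -- variable outside `V ∪ U`.
  have h4 := hw (Pi.single v 1) fun z hz => Pi.single_eq_of_ne
    (by rintro rfl; exact hvn (Or.inl hz)) _
  rw [weightedTotalDegree_piSingle, weightedTotalDegree_piSingle,
    degreeOf_eq_zero_of_notMem_vars fun h => hvn (hv v h)] at h4
  exact absurd h4 (not_le.mpr (degreeOf_pos_iff_mem_vars.mpr hvR))

/-- The saturated ideal of the members before `A i` is the contraction of `P`. -/
theorem IsCharacteristicSeq.mem_prevIdeal_iff (hC : IsCharacteristicSeq r P A)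
    (hA : IsAutoreducedWith r A u) (hP : P.IsPrime) (i : Fin p)
    (g : MvPolynomial (prevVars A i) k) :
    g ∈ prevIdeal r A i ↔ rename Subtype.val g ∈ P := by
  constructor
  · rintro ⟨s, hs, hsg⟩
    have h1 : rename Subtype.val (s * g) ∈ P := by
      refine (Ideal.span_le (I := P.comap (rename Subtype.val :
        MvPolynomial (prevVars A i) k →ₐ[k] DPoly l k))).mpr ?_ hsg
      rintro a ⟨j, -, ha⟩
      change rename Subtype.val a ∈ P
      rw [ha]
      exact hC.2.1 j
    have h2 : rename Subtype.val s ∉ P := by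
      have : s ∈ P.primeCompl.comap (rename Subtype.val :
          MvPolynomial (prevVars A i) k →ₐ[k] DPoly l k) := by
        refine Submonoid.closure_le.mpr ?_ hs
        rintro a ⟨j, -, v, hv, ha⟩
        change rename Subtype.val a ∉ P
        rw [ha, ← (hA.leader j).unique hv]
        exact hC.leadingCoeffIn_notMem hA hP.ne_top j
      exact this
    rw [map_mul] at h1
    exact (hP.mem_or_mem h1).resolve_left h2
  · intro hg
    have hvars : ∀ v ∈ (rename Subtype.val g : DPoly l k).vars, v ∈ prevVars A i := fun v hv => by
      obtain ⟨z, -, rfl⟩ := mem_vars_rename _ _ hv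
      exact z.2
    obtain ⟨s, hs, R, h1, h2, h3⟩ :=
      hA.exists_remainder_below i (rename Subtype.val g) fun v hv => Or.inl (hvars v hv)
    have hspan : Ideal.span {g | ∃ j < i, g = A j} ≤ P := by
      refine Ideal.span_le.mpr ?_
      rintro _ ⟨j, -, rfl⟩
      exact hC.2.1 j
    have hRP : R ∈ P := by
      have := P.sub_mem (P.mul_mem_left s hg) (hspan h1)
      rwa [sub_sub_cancel] at this
    -- Like `g`, the remainder is free of `u i`, so it is below `A i` and must vanish.
    have hR0 : R = 0 := by
      classical
      refine hC.eq_zero_of_isReducedBelow hA hP.ne_top hRP h2 (lt_of_le_of_lt ?_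
        (hA.leader i).degreeOf_pos)
      have h4 := h3 (Pi.single (u i) 1) fun z hz => Pi.single_eq_of_ne
        (by rintro rfl; exact hA.leader_notMem_prevVars i hz) _
      rwa [weightedTotalDegree_piSingle, weightedTotalDegree_piSingle,
        degreeOf_eq_zero_of_notMem_vars fun h => hA.leader_notMem_prevVars i (hvars _ h)] at h4
    rw [hR0, sub_zero] at h1
    -- This retraction onto `k[V]` carries the membership `h1` back to `k[V]`.
    let κ := killCompl (R := k) (Subtype.val_injective (p := (· ∈ prevVars A i)))
    have hκ : ∀ j < i, ∀ f : DPoly l k, f.vars ⊆ (A j).vars → rename Subtype.val (κ f) = f :=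
      fun j hj f hf => rename_killCompl_of_vars_subset fun v hv => ⟨j, hj, hf hv⟩
    refine ⟨κ s, ?_, ?_⟩
    · have : s ∈ (Submonoid.closure {g | ∃ j < i, IsInitial r (A j)
          (rename Subtype.val g)}).comap κ := by
        refine Submonoid.closure_le.mpr ?_ hs
        rintro _ ⟨j, hj, rfl⟩
        refine Submonoid.subset_closure ⟨j, hj, u j, hA.leader j, ?_⟩
        exact hκ j hj _ (vars_subset_of_degreeOf_le fun v => degreeOf_leadingCoeffIn_le v _ _)
      exact this
    · have hg' : κ (s * rename Subtype.val g) = κ s * g := by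
        rw [map_mul, killCompl_rename_app]
      rw [← hg']
      refine (Ideal.span_le (I := (Ideal.span {g | ∃ j < i, rename Subtype.val g = A j}).comap
        κ)).mpr ?_ h1
      rintro _ ⟨j, hj, rfl⟩
      exact Ideal.subset_span ⟨j, hj, hκ j hj _ subset_rfl⟩

theorem IsCharacteristicSeq.isPrime_prevIdeal (hC : IsCharacteristicSeq r P A)
    (hP : P.IsPrime) (i : Fin p) : (prevIdeal r A i).IsPrime := by
  obtain ⟨u, hA⟩ := isAutoreducedSeq_iff.mp hC.1
  have h : prevIdeal r A i = P.comap (rename Subtype.val :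
      MvPolynomial (prevVars A i) k →ₐ[k] DPoly l k) := by
    ext g
    exact hC.mem_prevIdeal_iff hA hP i g
  rw [h]
  exact Ideal.comap_isPrime _ _

theorem vars_mem_prevVars_or_newVars {i : Fin p} {v : DVar l} (hv : v ∈ (A i).vars) :
    v ∈ prevVars A i ∨ v ∈ newVars A i := by
  by_cases h : v ∈ prevVars A i
  · exact Or.inl h
  · exact Or.inr ⟨hv, h⟩

/-- The map to `Quot(k[V]/J)[U]` attached to `A i`. -/
noncomputable abbrev prevHom (r : Ranking l) (A : Fin p → DPoly l k) (i : Fin p) :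
    DPoly l k →+* MvPolynomial (newVars A i) (PrevFrac r A i) :=
  fracHom (prevVars A i) (newVars A i) (prevIdeal r A i)

theorem imageInPrevFrac_eq (i : Fin p) : imageInPrevFrac r A i = prevHom r A i (A i) := rfl

/-- The image of the initial is nonzero because the kernel lies in `P`. The leading term thus keeps
its full degree in `u i`, and the lower terms cannot cancel it. -/
theorem IsCharacteristicSeq.prevHom_ne_zero (hC : IsCharacteristicSeq r P A)
    (hA : IsAutoreducedWith r A u) (hP : P.IsPrime) (i : Fin p) : prevHom r A i (A i) ≠ 0 := by
  classical
  intro h0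
  have := hC.isPrime_prevIdeal hP i
  have hlc : prevHom r A i (leadingCoeffIn (u i) (A i)) ≠ 0 := fun h =>
    hC.leadingCoeffIn_notMem hA hP.ne_top i <| mem_of_fracHom_eq_zero (fun v hv => hv.2)
      (fun g hg => (hC.mem_prevIdeal_iff hA hP i g).mp hg)
      (fun v hv => vars_mem_prevVars_or_newVars
        (vars_subset_of_degreeOf_le (fun v => degreeOf_leadingCoeffIn_le v _ _) hv)) h
  have hpos := (hA.leader i).degreeOf_pos
  have h1 := degreeOf_sum_lower_lt hpos
  have h2 := congrArg (prevHom r A i) (leadingCoeffIn_mul_X_pow_add (u i) (A i))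
  generalize (∑ m ∈ (A i).support with ¬ m (u i) = (A i).degreeOf (u i),
    monomial m (coeff m (A i))) = G at h1 h2
  rw [h0, map_add, map_mul, map_pow,
    fracHom_X_of_notMem (hA.leader_notMem_prevVars i) (hA.leader_mem_newVars i)] at h2
  have h3 := degreeOf_mul_X_self_pow_eq_add_of_ne_zero
    (⟨u i, hA.leader_mem_newVars i⟩ : newVars A i) ((A i).degreeOf (u i)) hlc
  have h4 := degreeOf_fracHom_le (V := prevVars A i) (J := prevIdeal r A i)
    (⟨u i, hA.leader_mem_newVars i⟩ : newVars A i) G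
  rw [eq_neg_of_add_eq_zero_left h2.symm] at h3
  have h5 : degreeOf (⟨u i, hA.leader_mem_newVars i⟩ : newVars A i) (-prevHom r A i G) =
      degreeOf (⟨u i, hA.leader_mem_newVars i⟩ : newVars A i) (prevHom r A i G) := by
    rw [degreeOf_eq_sup, degreeOf_eq_sup, support_neg]
  rw [h5] at h3
  have h6 := h3.symm.le.trans h4
  exact absurd ((Nat.le_add_left _ _).trans h6) (not_le.mpr h1)

/-- A nonzero polynomial over `Quot(k[V]/J)` with a lift in `P` has at least the degree of
`A i`. -/
theorem IsMinimalCharacteristicSeq.newDegree_le_totalDegree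
    (hC : IsMinimalCharacteristicSeq r P A) (hA : IsAutoreducedWith r A u) (hP : P.IsPrime)
    {i : Fin p} {f : MvPolynomial (newVars A i) (PrevFrac r A i)} (hf : f ≠ 0)
    (hdeg : f.degreeOf ⟨u i, hA.leader_mem_newVars i⟩ ≤ (A i).degreeOf (u i))
    {a : MvPolynomial (prevVars A i) k} (ha : a ∉ prevIdeal r A i)
    {b : MvPolynomial (newVars A i) (MvPolynomial (prevVars A i) k)}
    (hb : map (toFrac (prevVars A i) (prevIdeal r A i)) b =
      C (toFrac (prevVars A i) (prevIdeal r A i) a) * f)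
    (hbw : ∀ w : newVars A i → ℕ, weightedTotalDegree w b ≤ weightedTotalDegree w f)
    (hbP : unpackHom (prevVars A i) (newVars A i) b ∈ P) : newDegree A i ≤ f.totalDegree := by
  classical
  have := hC.1.isPrime_prevIdeal hP i
  have hUV : ∀ v ∈ newVars A i, v ∉ prevVars A i := fun v hv => hv.2
  have hw : ∀ w : DVar l → ℕ, (∀ v ∈ prevVars A i, w v = 0) →
      weightedTotalDegree w (unpackHom (prevVars A i) (newVars A i) b) ≤
        weightedTotalDegree (fun v : newVars A i => w v) f := fun w hw =>
    (weightedTotalDegree_unpackHom_le hw b).trans (hbw _)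
  have hvars : ∀ v ∈ (unpackHom (prevVars A i) (newVars A i) b).vars,
      v ∈ prevVars A i ∨ v ∈ newVars A i := fun v hv => by
    by_contra h
    have h1 := hw (Pi.single v 1) fun z hz => Pi.single_eq_of_ne
      (by rintro rfl; exact h (Or.inl hz)) _
    have h2 : weightedTotalDegree (fun z : newVars A i => (Pi.single v 1 : DVar l → ℕ) z) f = 0 :=
      weightedTotalDegree_eq_zero_of_vars fun z _ => Pi.single_eq_of_ne
        (fun hz : z.val = v => h (Or.inr (hz ▸ z.2))) _
    rw [h2, weightedTotalDegree_piSingle] at h1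
    exact absurd h1 (not_le.mpr (degreeOf_pos_iff_mem_vars.mpr hv))
  -- The lift need not be reduced with respect to the earlier members. Its remainder `R` is, and is
  -- still in `P`.
  obtain ⟨s, hs, R, h1, h2, h3⟩ := hA.exists_remainder_below i _ hvars
  have hspan : Ideal.span {g | ∃ j < i, g = A j} ≤ P := by
    refine Ideal.span_le.mpr ?_
    rintro _ ⟨j, -, rfl⟩
    exact hC.1.2.1 j
  have hRP : R ∈ P := by
    have := P.sub_mem (P.mul_mem_left s hbP) (hspan h1)
    rwa [sub_sub_cancel] at this
  have hker : ∀ g ∈ Ideal.span {g | ∃ j < i, g = A j}, prevHom r A i g = 0 := by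
    have : Ideal.span {g | ∃ j < i, g = A j} ≤ RingHom.ker (prevHom r A i) := by
      refine Ideal.span_le.mpr ?_
      rintro _ ⟨j, hj, rfl⟩
      have h4 : rename Subtype.val (killCompl (Subtype.val_injective (p := (· ∈ prevVars A i)))
          (A j)) = A j := rename_killCompl_of_vars_subset fun v hv => ⟨j, hj, hv⟩
      change prevHom r A i (A j) = 0
      have h5 : killCompl (Subtype.val_injective (p := (· ∈ prevVars A i))) (A j) ∈
          prevIdeal r A i := by
        rw [hC.1.mem_prevIdeal_iff hA hP, h4]
        exact hC.1.2.1 j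
      rw [← h4, fracHom_rename, toFrac_eq_zero_iff.mpr h5, C_0]
    exact fun g hg => this hg
  have hs0 : prevHom r A i s ≠ 0 := by
    have : s ∈ (nonZeroDivisors (MvPolynomial (newVars A i) (PrevFrac r A i))).comap
        (prevHom r A i) := by
      refine Submonoid.closure_le.mpr ?_ hs
      rintro _ ⟨j, hj, rfl⟩
      refine mem_nonZeroDivisors_of_ne_zero fun h => ?_
      have h4 : rename Subtype.val (killCompl (Subtype.val_injective (p := (· ∈ prevVars A i)))
          (leadingCoeffIn (u j) (A j))) = leadingCoeffIn (u j) (A j) :=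
        rename_killCompl_of_vars_subset fun v hv => ⟨j, hj,
          vars_subset_of_degreeOf_le (fun v => degreeOf_leadingCoeffIn_le v _ _) hv⟩
      rw [← h4, fracHom_rename, C_eq_zero, toFrac_eq_zero_iff,
        hC.1.mem_prevIdeal_iff hA hP, h4] at h
      exact hC.1.leadingCoeffIn_notMem hA hP.ne_top j h
    exact nonZeroDivisors.ne_zero this
  -- Over the fraction field the earlier members vanish and their initials do not. If `R` were 0,
  -- the nonzero product of the images of `s`, `a` and `f` would vanish.
  have hR0 : R ≠ 0 := by
    rintro rfl
    rw [sub_zero] at h1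
    have h4 := hker _ h1
    rw [map_mul, fracHom_unpackHom hUV, hb] at h4
    refine mul_ne_zero hs0 (mul_ne_zero ?_ hf) h4
    rwa [Ne, C_eq_zero, toFrac_eq_zero_iff]
  have hdegR : R.degreeOf (u i) ≤ (A i).degreeOf (u i) := by
    have h0 : ∀ z ∈ prevVars A i, (Pi.single (u i) 1 : DVar l → ℕ) z = 0 := fun z hz =>
      Pi.single_eq_of_ne (by rintro rfl; exact hA.leader_notMem_prevVars i hz) _
    have h4 := (h3 _ h0).trans (hw _ h0)
    have h5 : (fun z : newVars A i => (Pi.single (u i) 1 : DVar l → ℕ) z) =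
        Pi.single ⟨u i, hA.leader_mem_newVars i⟩ 1 := by
      funext z
      simp only [Pi.single_apply, Subtype.ext_iff]
    rw [h5, weightedTotalDegree_piSingle, weightedTotalDegree_piSingle] at h4
    exact h4.trans hdeg
  have h0 : ∀ z ∈ prevVars A i, newWeight A i z = 0 := fun z hz => newWeight_of_mem hz
  have h4 := (h3 _ h0).trans (hw _ h0)
  -- On `U` every weight is 1, so the degree in new variables becomes the total degree.
  have h5 : (fun z : newVars A i => newWeight A i z) = 1 := by
    funext z
    exact newWeight_of_notMem z.2.2
  rw [h5, weightedTotalDegree_one] at h4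
  exact (hC.newDegree_le hA hP.ne_top hRP hR0 h2 hdegR).trans h4

theorem IsMinimalCharacteristicSeq.irreducible_imageInPrevFrac
    (hC : IsMinimalCharacteristicSeq r P A) (hP : P.IsPrime) (i : Fin p) :
    Irreducible (imageInPrevFrac r A i) := by
  classical
  obtain ⟨u, hA⟩ := isAutoreducedSeq_iff.mp hC.1.1
  have := hC.1.isPrime_prevIdeal hP i
  have hUV : ∀ v ∈ newVars A i, v ∉ prevVars A i := fun v hv => hv.2
  have hne := hC.1.prevHom_ne_zero hA hP i
  have htot : (prevHom r A i (A i)).totalDegree ≤ newDegree A i := by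
    have h := weightedTotalDegree_fracHom_le (V := prevVars A i) (U := newVars A i)
      (J := prevIdeal r A i) (newWeight A i) (A i)
    have h5 : (fun z : newVars A i => newWeight A i z) = 1 := by
      funext z
      exact newWeight_of_notMem z.2.2
    rwa [h5, weightedTotalDegree_one] at h
  have hdegA := degreeOf_fracHom_le (V := prevVars A i) (J := prevIdeal r A i)
    (⟨u i, hA.leader_mem_newVars i⟩ : newVars A i) (A i)
  obtain ⟨c, hc⟩ := exists_unpackHom_eq (V := prevVars A i) (U := newVars A i)
    fun v (hv : v ∈ (A i).vars) => vars_mem_prevVars_or_newVars hv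
  -- A lift of `a` times the image of `A i` differs from a multiple of `A i` only by coefficients in
  -- `J`.
  have hmem : ∀ b a, map (toFrac (prevVars A i) (prevIdeal r A i)) b =
      C (toFrac (prevVars A i) (prevIdeal r A i) a) * prevHom r A i (A i) →
      unpackHom (prevVars A i) (newVars A i) b ∈ P := fun b a hb => by
    have h1 : map (toFrac (prevVars A i) (prevIdeal r A i)) (b - C a * c) = 0 := by
      rw [_root_.map_sub, _root_.map_mul, map_C, ← fracHom_unpackHom hUV c, hc, hb, sub_self]
    have h3 := unpackHom_mem (fun g hg => (hC.1.mem_prevIdeal_iff hA hP i g).mp hg) h1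
    rw [map_sub, map_mul, hc] at h3
    have := P.add_mem h3 (P.mul_mem_left (unpackHom (prevVars A i) (newVars A i) (C a))
      (hC.1.2.1 i))
    rwa [sub_add_cancel] at this
  have key : ∀ f g : MvPolynomial (newVars A i) (PrevFrac r A i),
      prevHom r A i (A i) = f * g → ∀ a ∉ prevIdeal r A i,
      ∀ b, map (toFrac (prevVars A i) (prevIdeal r A i)) b =
        C (toFrac (prevVars A i) (prevIdeal r A i) a) * f →
      (∀ w : newVars A i → ℕ, weightedTotalDegree w b ≤ weightedTotalDegree w f) →
      unpackHom (prevVars A i) (newVars A i) b ∈ P → IsUnit g := by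
    intro f g hfg a ha b hb hbw hbP
    rw [hfg] at hne htot hdegA
    have hf0 := left_ne_zero_of_mul hne
    have hg0 := right_ne_zero_of_mul hne
    rw [degreeOf_mul_eq hf0 hg0] at hdegA
    rw [totalDegree_mul_of_isDomain hf0 hg0] at htot
    have h1 := hC.newDegree_le_totalDegree hA hP hf0 ((Nat.le_add_right _ _).trans hdegA)
      ha hb hbw hbP
    exact isUnit_of_totalDegree_eq_zero hg0 (by omega)
  rw [imageInPrevFrac_eq]
  refine ⟨fun hu => ?_, fun f g hfg => ?_⟩
  -- A unit has total degree 0, which would force `A i` to have degree 0 in its new variables. But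
  -- its leader is one of them.
  · obtain ⟨a, ha, b, hb, hbw⟩ := exists_lift_fractionRing (prevIdeal r A i)
      (prevHom r A i (A i))
    have h1 := hC.newDegree_le_totalDegree hA hP hne hdegA ha hb hbw (hmem b a hb)
    rw [(isUnit_iff_totalDegree_of_isReduced.mp hu).2, newDegree] at h1
    obtain ⟨m, hm, hv⟩ := (mem_vars_iff_mem_support _).mp (hA.leader i).1
    have h2 := (Finsupp.le_weight (newWeight A i) (s := u i)
      (by rw [newWeight_of_notMem (hA.leader_notMem_prevVars i)]; exact one_ne_zero) m).trans
      ((le_weightedTotalDegree (newWeight A i) hm).trans h1)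
    exact Finsupp.mem_support_iff.mp hv (Nat.le_zero.mp h2)
  · obtain ⟨a, ha, b, hb, hbw⟩ := exists_lift_fractionRing (prevIdeal r A i) f
    obtain ⟨a', ha', b', hb', hbw'⟩ := exists_lift_fractionRing (prevIdeal r A i) g
    -- The product of the lifts is a lift of a multiple of `A i`, hence in `P`. As `P` is prime, one
    -- lift is in `P`, and the opposite factor is the unit.
    have h1 : map (toFrac (prevVars A i) (prevIdeal r A i)) (b * b') =
        C (toFrac (prevVars A i) (prevIdeal r A i) (a * a')) * prevHom r A i (A i) := by
      rw [map_mul, toFrac, hb, hb', hfg, map_mul, C_mul, RingHom.comp_apply, RingHom.comp_apply]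
      ring
    have h2 := hmem _ _ h1
    rw [map_mul] at h2
    rcases hP.mem_or_mem h2 with h | h
    · exact Or.inr (key f g hfg a ha b hb hbw h)
    · exact Or.inl (key g f (hfg.trans (mul_comm f g)) a' ha' b' hb' hbw' h)

/-- Every variable is new here, so the degree is the total degree. A factor in `P` can replace `A i`
directly, which leaves degree 0 for the other factor. -/
theorem IsMinimalCharacteristicSeq.irreducible_first (hC : IsMinimalCharacteristicSeq r P A)
    (hP : P.IsPrime) {i : Fin p} (hi : i.val = 0) : Irreducible (A i) := by
  obtain ⟨u, hA⟩ := isAutoreducedSeq_iff.mp hC.1.1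
  have hw : newWeight A i = 1 := by
    funext v
    refine newWeight_of_notMem ?_
    rintro ⟨j, hj, -⟩
    have := Fin.lt_def.mp hj
    omega
  have hne : A i ≠ 0 := fun h => (hA.leader i).not_isConst ⟨0, by rw [h, C_0]⟩
  have key : ∀ f g : DPoly l k, A i = f * g → f ∈ P → IsUnit g := fun f g hfg hf => by
    have hf0 : f ≠ 0 := fun h => hne (by rw [hfg, h, zero_mul])
    have hg0 : g ≠ 0 := fun h => hne (by rw [hfg, h, mul_zero])
    have hdeg : ∀ v, f.degreeOf v ≤ (A i).degreeOf v := fun v => by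
      rw [hfg, degreeOf_mul_eq hf0 hg0]
      exact Nat.le_add_right _ _
    have h := hC.newDegree_le hA hP.ne_top hf hf0 ((hA.isReducedBelow i).mono hdeg) (hdeg _)
    rw [newDegree, hw, weightedTotalDegree_one, weightedTotalDegree_one, hfg,
      totalDegree_mul_of_isDomain hf0 hg0] at h
    refine isUnit_iff_totalDegree_of_isReduced.mpr ⟨?_, by omega⟩
    have hg := totalDegree_eq_zero_iff_eq_C.mp (show g.totalDegree = 0 by omega)
    refine isUnit_iff_ne_zero.mpr fun h0 => hg0 ?_
    rw [hg, h0, C_0]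
  refine ⟨fun hu => hP.ne_top (Ideal.eq_top_of_isUnit_mem _ (hC.1.2.1 i) hu), fun f g hfg => ?_⟩
  rcases hP.mem_or_mem (hfg ▸ hC.1.2.1 i) with h | h
  · exact Or.inr (key f g hfg h)
  · exact Or.inl (key g f (hfg.trans (mul_comm f g)) h)

end Irreducibility

end DiffAlg

/-! ### The theorem, for a minimal characteristic set -/

theorem lemma3p2 {k : Type*} [Field k] [CharZero k] [Differential k] {l : ℕ}
    (r : DiffAlg.Ranking l) (P : Ideal (DiffAlg.DPoly l k)) (hP : P.IsPrime)
    (hPd : DiffAlg.IsDifferentialIdeal P) :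
    ∃ (p : ℕ) (C : Fin p → DiffAlg.DPoly l k),
      DiffAlg.IsCharacteristicSeq r P C ∧
      DiffAlg.IsIrreducibleSeq r C ∧
      ∀ (t : Fin l) (s : ℕ) (i : Fin p),
        (∀ (j : Fin p) (s' : ℕ), (t, s') ∈ (C j).vars → s' ≤ s) →
        (∀ j < i, (t, s) ∉ (C j).vars) →
        (t, s) ∈ (C i).vars →
        MvPolynomial.pderiv (t, s) (C i) ∉ P := by
  obtain ⟨p, A, hA⟩ := DiffAlg.exists_isMinimalCharacteristicSeq r P
  refine ⟨p, A, hA.1, ⟨fun i hi => hA.irreducible_first hP hi, fun i _ =>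
    ⟨hA.1.isPrime_prevIdeal hP i, hA.irreducible_imageInPrevFrac hP i⟩⟩, ?_⟩
  intro t s i _ hprev hv
  exact hA.pderiv_notMem hP.ne_top hv fun ⟨j, hj, h⟩ => hprev j hj h
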